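/- Let $(\Sigma,g)$ be an oriented smooth Riemannian surface (without boundary) with nonpositive curvature, and let $J$ be the complex structure on $\Sigma$ compatible with $g$, i.e. the rotation by $\pi/2$ in the tangent planes ($J$ is smooth, $J^2=-1$, $g(Jv,Jw)=g(v,w)$). Let $\mathbb{D}\subset\mathbb{C}$ be the open unit disc and let $u:\overline{\mathbb{D}}\to\Sigma$ be a smooth map (smooth up to the boundary) which is holomorphic on $\mathbb{D}$ as a map to $(\Sigma,J)$, i.e. $du\circ i=J\circ du$ on $\mathbb{D}$. Let $\partial_\theta$ be the angular vector field on $\overline{\mathbb{D}}$, whose value at $z=re^{i\theta}$ is $iz$. Then the length functional \[ L:(0,1]\to\mathbb{R},\qquad L(r)=\int_0^{2\pi}\bigl\|du|_{re^{i\theta}}(\partial_\theta)\bigr\|_g\,d\theta \] is well defined (the integrand is integrable for every $r\in(0,1]$), nondecreasing in $r$, and convex as a function of $\log r$, i.e. $t\mapsto L(e^t)$ is convex on $(-\infty,0]$. Moreover, the function $z\mapsto\|du_z(\partial_\theta)\|_g$ is subharmonic on $\mathbb{D}$. -/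

import Mathlib

open Bundle Manifold
open scoped ContDiff

/-- A smooth Riemannian metric on a smooth manifold `S` without boundary, modelled on the real
vector space `E` (below, `E` is a plane, and `S` is a surface). The value of the metric at `p` is
`g.inner p`. -/
abbrev SmoothMetric (E : Type*) [NormedAddCommGroup E] [NormedSpace ℝ E]
    (S : Type*) [TopologicalSpace S] [ChartedSpace E S] [IsManifold 𝓘(ℝ, E) ∞ S] :=
  ContMDiffRiemannianMetric 𝓘(ℝ, E) ∞ E (fun p : S => TangentSpace 𝓘(ℝ, E) p)

section Curvature

variable {E : Type*} [NormedAddCommGroup E] [NormedSpace ℝ E]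
  {S : Type*} [TopologicalSpace S] [ChartedSpace E S] [IsManifold 𝓘(ℝ, E) ∞ S]

/-- The partial derivative `∂ᵢ f` of a function on the plane `E`, for the linear coordinates of
`E` given by the basis `b`. -/
noncomputable def partialDeriv (b : Module.Basis (Fin 2) ℝ E) (i : Fin 2) (f : E → ℝ) (y : E) :
    ℝ :=
  fderiv ℝ f y (b i)

/-- The coordinate vector field `∂ᵢ` of the chart `e` (with the linear coordinates of `E` given
by `b`), at the point with coordinates `y`. -/
noncomputable def coordVector (b : Module.Basis (Fin 2) ℝ E)
    (e : OpenPartialHomeomorph S E) (i : Fin 2) (y : E) :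
    TangentSpace 𝓘(ℝ, E) (e.symm y) :=
  mfderiv 𝓘(ℝ, E) 𝓘(ℝ, E) e.symm y (b i)

/-- The matrix `gᵢⱼ = g(∂ᵢ, ∂ⱼ)` of the metric in the chart `e`, at the coordinates `y`. -/
noncomputable def metricMatrix (g : SmoothMetric E S) (b : Module.Basis (Fin 2) ℝ E)
    (e : OpenPartialHomeomorph S E) (y : E) : Matrix (Fin 2) (Fin 2) ℝ :=
  Matrix.of fun i j => g.inner (e.symm y) (coordVector b e i y) (coordVector b e j y)

/-- The Christoffel symbols of the Levi-Civita connection in the chart `e`: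
`Γᵏᵢⱼ = ½ ∑ₗ gᵏˡ (∂ᵢ gⱼₗ + ∂ⱼ gᵢₗ - ∂ₗ gᵢⱼ)`. -/
noncomputable def christoffel (g : SmoothMetric E S) (b : Module.Basis (Fin 2) ℝ E)
    (e : OpenPartialHomeomorph S E) (k i j : Fin 2) (y : E) : ℝ :=
  (1 / 2 : ℝ) * ∑ l : Fin 2, (metricMatrix g b e y)⁻¹ k l *
    (partialDeriv b i (fun x => metricMatrix g b e x j l) y
      + partialDeriv b j (fun x => metricMatrix g b e x i l) y
      - partialDeriv b l (fun x => metricMatrix g b e x i j) y)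

/-- The coefficient along `∂ₗ` of the vector `R(∂ᵢ, ∂ⱼ)∂ₖ = ∇ᵢ∇ⱼ∂ₖ - ∇ⱼ∇ᵢ∂ₖ`. -/
noncomputable def curvatureCoeff (g : SmoothMetric E S) (b : Module.Basis (Fin 2) ℝ E)
    (e : OpenPartialHomeomorph S E) (l i j k : Fin 2) (y : E) : ℝ :=
  partialDeriv b i (christoffel g b e l j k) y - partialDeriv b j (christoffel g b e l i k) y
    + ∑ m : Fin 2, (christoffel g b e l i m y * christoffel g b e m j k y
      - christoffel g b e l j m y * christoffel g b e m i k y)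

/-- The Gauss curvature `K = g(R(∂₀, ∂₁)∂₁, ∂₀) / det (gᵢⱼ)`, computed in the chart `e` at the
coordinates `y ∈ e.target`. -/
noncomputable def gaussCurvature (g : SmoothMetric E S) (b : Module.Basis (Fin 2) ℝ E)
    (e : OpenPartialHomeomorph S E) (y : E) : ℝ :=
  (∑ l : Fin 2, curvatureCoeff g b e l 0 1 1 y * metricMatrix g b e y l 0)
    / (metricMatrix g b e y).det

/-- The metric has nonpositive (Gauss, equivalently scalar) curvature: in every chart of the
atlas, the curvature is nonpositive at every point of the chart. (Neither the chart nor the basis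
`b` of the plane `E` affects the value of the curvature at a point.) -/
def HasNonposCurvature (g : SmoothMetric E S) : Prop :=
  ∀ (b : Module.Basis (Fin 2) ℝ E), ∀ e ∈ atlas E S, ∀ y ∈ e.target, gaussCurvature g b e y ≤ 0

/-- `J` is a complex structure on the surface compatible with the metric `g`: a smooth field of
endomorphisms of the tangent planes with `J² = -1` and `g(J v, J w) = g(v, w)`. Such a `J` is the
rotation by the angle `π / 2` in the tangent planes, for an orientation of the surface; giving
`J` is the same as orienting the surface. -/
structure IsCompatibleComplexStructure (g : SmoothMetric E S)
    (J : ∀ p : S, TangentSpace 𝓘(ℝ, E) p →L[ℝ] TangentSpace 𝓘(ℝ, E) p) : Prop where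
  smooth : ContMDiff 𝓘(ℝ, E) (𝓘(ℝ, E).prod 𝓘(ℝ, E →L[ℝ] E)) ∞
    (fun p : S => TotalSpace.mk' (E →L[ℝ] E)
      (E := fun p : S => TangentSpace 𝓘(ℝ, E) p →L[ℝ] TangentSpace 𝓘(ℝ, E) p) p (J p))
  sq_eq_neg : ∀ (p : S) (v : TangentSpace 𝓘(ℝ, E) p), J p (J p v) = -v
  isometry : ∀ (p : S) (v w : TangentSpace 𝓘(ℝ, E) p), g.inner p (J p v) (J p w) = g.inner p v w

end Curvature

section Maps

variable {E : Type*} [NormedAddCommGroup E] [NormedSpace ℝ E]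
  {S : Type*} [TopologicalSpace S] [ChartedSpace E S] [IsManifold 𝓘(ℝ, E) ∞ S]

/-- `u` is holomorphic on the open set `U ⊆ ℂ`, as a map to the surface with the complex
structure `J`: it is (real) differentiable with `du ∘ i = J ∘ du`. -/
def IsHolomorphicInto (J : ∀ p : S, TangentSpace 𝓘(ℝ, E) p →L[ℝ] TangentSpace 𝓘(ℝ, E) p)
    (u : ℂ → S) (U : Set ℂ) : Prop :=
  ∀ z ∈ U, MDifferentiableAt 𝓘(ℝ, ℂ) 𝓘(ℝ, E) u z ∧
    ∀ v : ℂ, mfderiv 𝓘(ℝ, ℂ) 𝓘(ℝ, E) u z (Complex.I * v : ℂ)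
      = J (u z) (mfderiv 𝓘(ℝ, ℂ) 𝓘(ℝ, E) u z v)

/-- The norm `‖du(∂_θ)‖_g` at `z`, for a map `u` of the closed unit disc. As
`∂_θ (r e^{iθ}) = i r e^{iθ}`, the vector `∂_θ` at `z` is `i z`. Only the values of `u` on the
closed unit disc matter. -/
noncomputable def angularSpeed (g : SmoothMetric E S) (u : ℂ → S) (z : ℂ) : ℝ :=
  Real.sqrt (g.inner (u z)
    (mfderivWithin 𝓘(ℝ, ℂ) 𝓘(ℝ, E) u (Metric.closedBall 0 1) z (Complex.I * z : ℂ))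
    (mfderivWithin 𝓘(ℝ, ℂ) 𝓘(ℝ, E) u (Metric.closedBall 0 1) z (Complex.I * z : ℂ)))

/-- The length functional: `L(r) = ∫₀^{2π} ‖du(∂_θ)‖_g dθ` over the circle of radius `r`;
here `circleMap 0 r θ = r e^{iθ}`. -/
noncomputable def circleLength (g : SmoothMetric E S) (u : ℂ → S) (r : ℝ) : ℝ :=
  ∫ θ in (0 : ℝ)..(2 * Real.pi), angularSpeed g u (circleMap 0 r θ)

end Maps

/-- A (finite-valued) function is subharmonic on `U ⊆ ℂ`: it is upper semicontinuous, and for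
every closed disc contained in `U` its value at the centre is at most its (well-defined) mean
over the boundary circle. -/
def IsSubharmonicOn (f : ℂ → ℝ) (U : Set ℂ) : Prop :=
  UpperSemicontinuousOn f U ∧
    ∀ (c : ℂ) (ρ : ℝ), 0 < ρ → Metric.closedBall c ρ ⊆ U →
      CircleIntegrable f c ρ ∧ f c ≤ Real.circleAverage f c ρ

/-! ### Integrals over concentric circles of functions with nonnegative Laplacian. -/

section CircleMeans

open MeasureTheory Metric Set Filter Topology

/-! On the open disc `du` is conformal, so the squared angular speed is F = |z|²B with B = |du(1)|².
The heart of the matter is that log B is subharmonic where B > 0. A conformal immersion of a plane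
domain into a surface is harmonic, and a Bochner computation then gives B ΔB = |∇B|² - 2B g(R(a,c)c,
a) with a = du(1), c = du(i); nonpositive curvature gives |∇B|² ≤ B ΔB
(`IsLeviCivitaOn.log_laplacian_energy`). This form of the inequality avoids logarithms and division,
and passes to products (`log_laplacian_mul`); as log |z|² is harmonic away from 0, F satisfies it
too.

Hence √F should be subharmonic, but it need not be smooth at the zeros of F. For ε ≠ 0 the function
√(F + ε²) is C² with nonnegative Laplacian, even at zeros of F, which are minima of F
(`planeLaplacian_sqrt_nonneg`). For such a function the circle integral is convex in log r; being
bounded as r → 0 it is nondecreasing, and its limit at r = 0 gives the sub-mean-value inequality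
(`circle_integrals_of_planeLaplacian_nonneg`). All three conclusions survive ε → 0
(`circle_integrals_sqrt`). The radius 1 costs only continuity up to the boundary.

The curvature computation takes place in a chart, the Christoffel symbols being read as a bilinear
map on the model plane; `isLeviCivitaOn_christoffelForm` connects the coordinate formulas with it.
-/

theorem hasDerivAt_circleMap_exp (c : ℂ) (ρ θ t : ℝ) :
    HasDerivAt (fun s : ℝ => circleMap c (ρ * Real.exp s) θ)
      (circleMap c (ρ * Real.exp t) θ - c) t := by
  have h : HasDerivAt (fun s : ℝ => ((ρ * Real.exp s : ℝ) : ℂ)) ((ρ * Real.exp t : ℝ) : ℂ) t :=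
    ((Real.hasDerivAt_exp t).const_mul ρ).ofReal_comp
  have h2 := (h.mul_const (Complex.exp (θ * Complex.I))).const_add c
  rw [circleMap_sub_center, circleMap_zero]
  exact h2

theorem circleMap_mem_ball_of_neg {c : ℂ} {ρ t : ℝ} (hρ : 0 < ρ) (ht : t < 0) (θ : ℝ) :
    circleMap c (ρ * Real.exp t) θ ∈ ball c ρ := by
  have h1 : 0 < ρ * Real.exp t := mul_pos hρ (Real.exp_pos t)
  have h2 : Real.exp t < 1 := Real.exp_lt_one_iff.2 ht
  have := circleMap_mem_sphere c h1.le θ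
  rw [mem_sphere] at this
  rw [mem_ball, this]
  nlinarith

theorem circleMap_mem_closedBall_of_nonpos {c : ℂ} {ρ t : ℝ} (hρ : 0 < ρ) (ht : t ≤ 0) (θ : ℝ) :
    circleMap c (ρ * Real.exp t) θ ∈ closedBall c ρ := by
  have h1 : 0 < ρ * Real.exp t := mul_pos hρ (Real.exp_pos t)
  have h2 : Real.exp t ≤ 1 := Real.exp_le_one_iff.2 ht
  have := circleMap_mem_sphere c h1.le θ
  rw [mem_sphere] at this
  rw [mem_closedBall, this]
  nlinarith

/-- The circle means of a `C¹` function can be differentiated under the integral sign, in the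
logarithm of the radius. -/
theorem hasDerivAt_integral_circleMap_exp {Q : ℂ → ℝ} {c : ℂ} {ρ : ℝ} (hρ : 0 < ρ)
    (hQ : ContDiffOn ℝ 1 Q (ball c ρ)) {t : ℝ} (ht : t < 0) :
    HasDerivAt (fun s => ∫ θ in (0 : ℝ)..(2 * Real.pi), Q (circleMap c (ρ * Real.exp s) θ))
      (∫ θ in (0 : ℝ)..(2 * Real.pi), fderiv ℝ Q (circleMap c (ρ * Real.exp t) θ)
        (circleMap c (ρ * Real.exp t) θ - c)) t := by
  -- Circles with logarithmic radius below t' stay in a compact subdisc of the open disc, which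
  -- supplies the dominating constant.
  obtain ⟨t', htt', ht'⟩ := exists_between ht
  have hdQ : ContinuousOn (fun z => fderiv ℝ Q z (z - c)) (ball c ρ) :=
    (hQ.continuousOn_fderiv_of_isOpen isOpen_ball le_rfl).clm_apply
      (continuousOn_id.sub continuousOn_const)
  have hcirc (s : ℝ) (hs : s < 0) {f : ℂ → ℝ} (hf : ContinuousOn f (ball c ρ)) :
      Continuous fun θ => f (circleMap c (ρ * Real.exp s) θ) :=
    hf.comp_continuous (continuous_circleMap _ _) fun θ => circleMap_mem_ball_of_neg hρ hs θ
  have hsub : closedBall c (ρ * Real.exp t') ⊆ ball c ρ :=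
    closedBall_subset_ball (by nlinarith [Real.exp_lt_one_iff.2 ht'])
  obtain ⟨C, hC⟩ := (isCompact_closedBall c (ρ * Real.exp t')).exists_bound_of_continuousOn
    (hdQ.mono hsub)
  refine (intervalIntegral.hasDerivAt_integral_of_dominated_loc_of_deriv_le (μ := volume)
    (F := fun s θ => Q (circleMap c (ρ * Real.exp s) θ))
    (F' := fun s θ => fderiv ℝ Q (circleMap c (ρ * Real.exp s) θ)
        (circleMap c (ρ * Real.exp s) θ - c)) (bound := fun _ => C)
    (Iio_mem_nhds htt') ?_ ?_ ?_ ?_ ?_ ?_).2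
  · filter_upwards [Iio_mem_nhds ht] with s hs
    exact (hcirc s hs hQ.continuousOn).aestronglyMeasurable
  · exact (hcirc t ht hQ.continuousOn).intervalIntegrable _ _
  · exact (hcirc t ht hdQ).aestronglyMeasurable
  · refine Eventually.of_forall fun θ _ s hs => hC _ ?_
    have h1 : Real.exp s ≤ Real.exp t' := Real.exp_le_exp.2 (le_of_lt hs)
    exact closedBall_subset_closedBall (mul_le_mul_of_nonneg_left h1 hρ.le)
      (circleMap_mem_closedBall c (by positivity) θ)
  · exact intervalIntegrable_const
  · refine Eventually.of_forall fun θ _ s hs => ?_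
    have hmem := circleMap_mem_ball_of_neg (c := c) hρ (lt_trans hs ht') θ
    have h1 : HasFDerivAt Q _ (circleMap c (ρ * Real.exp s) θ) :=
      ((hQ.differentiableOn one_ne_zero).differentiableAt (isOpen_ball.mem_nhds hmem)).hasFDerivAt
    exact h1.comp_hasDerivAt s (hasDerivAt_circleMap_exp c ρ θ s)

/-- The Laplacian of a function on the complex plane. -/
noncomputable def planeLaplacian (F : ℂ → ℝ) (z : ℂ) : ℝ :=
  fderiv ℝ (fderiv ℝ F) z 1 1 + fderiv ℝ (fderiv ℝ F) z Complex.I Complex.I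

/-- The vectors w and iw form an orthogonal frame of length ‖w‖; the cross terms cancel because the
second derivative is symmetric. -/
theorem planeLaplacian_rotate {F : ℂ → ℝ} {z : ℂ} (hF : ContDiffAt ℝ 2 F z) (w : ℂ) :
    fderiv ℝ (fderiv ℝ F) z w w + fderiv ℝ (fderiv ℝ F) z (Complex.I * w) (Complex.I * w)
      = ‖w‖ ^ 2 * planeLaplacian F z := by
  have hsymm : fderiv ℝ (fderiv ℝ F) z 1 Complex.I = fderiv ℝ (fderiv ℝ F) z Complex.I 1 :=
    (hF.isSymmSndFDerivAt (by simp)).eq _ _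
  have hw : w = w.re • (1 : ℂ) + w.im • Complex.I := by
    apply Complex.ext <;> simp
  have hIw : Complex.I * w = (-w.im) • (1 : ℂ) + w.re • Complex.I := by
    apply Complex.ext <;> simp
  rw [hIw, ← Complex.normSq_eq_norm_sq, Complex.normSq_apply, planeLaplacian]
  nth_rewrite 1 2 [hw]
  simp only [map_add, map_smul, add_apply, smul_apply,
    smul_eq_mul, hsymm]
  ring

/-- With w = z - c, the second derivative in log r of the circle integral is the integral of
D²K(w,w) + DK(w). Adding an exact θ-derivative, whose integral over the circle vanishes, turns the
integrand into |w|²ΔK ≥ 0. -/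
theorem convexOn_integral_circleMap_exp {K : ℂ → ℝ} {c : ℂ} {ρ : ℝ} (hρ : 0 < ρ)
    (hK : ContDiffOn ℝ 2 K (ball c ρ)) (hlap : ∀ z ∈ ball c ρ, 0 ≤ planeLaplacian K z)
    (hcont : ContinuousOn
      (fun t => ∫ θ in (0 : ℝ)..(2 * Real.pi), K (circleMap c (ρ * Real.exp t) θ)) (Iic 0)) :
    ConvexOn ℝ (Iic 0)
      (fun t => ∫ θ in (0 : ℝ)..(2 * Real.pi), K (circleMap c (ρ * Real.exp t) θ)) := by
  have hdK : ContDiffOn ℝ 1 (fderiv ℝ K) (ball c ρ) :=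
    hK.fderiv_of_isOpen isOpen_ball (by norm_num)
  have hsub : ContDiff ℝ 1 fun z : ℂ => z - c := contDiff_id.sub contDiff_const
  have hQ : ContDiffOn ℝ 1 (fun z => fderiv ℝ K z (z - c)) (ball c ρ) :=
    hdK.clm_apply hsub.contDiffOn
  have hdQ {z : ℂ} (hz : z ∈ ball c ρ) : HasFDerivAt (fderiv ℝ K) (fderiv ℝ (fderiv ℝ K) z) z :=
    ((hdK.differentiableOn one_ne_zero).differentiableAt (isOpen_ball.mem_nhds hz)).hasFDerivAt
  have hQ' {z : ℂ} (hz : z ∈ ball c ρ) (v : ℂ) : fderiv ℝ (fun z => fderiv ℝ K z (z - c)) z v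
      = fderiv ℝ (fderiv ℝ K) z v (z - c) + fderiv ℝ K z v := by
    have := ((hdQ hz).clm_apply ((hasFDerivAt_id z).sub_const c)).fderiv
    simp only [id] at this
    rw [this]
    simp [add_comm]
  refine convexOn_of_hasDerivWithinAt2_nonneg (convex_Iic 0) hcont (fun t ht => ?_) (fun t ht => ?_)
    (fun t ht => ?_)
    (f' := fun t => ∫ θ in (0 : ℝ)..(2 * Real.pi), fderiv ℝ K (circleMap c (ρ * Real.exp t) θ)
        (circleMap c (ρ * Real.exp t) θ - c))
    (f'' := fun t => ∫ θ in (0 : ℝ)..(2 * Real.pi),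
      fderiv ℝ (fun z => fderiv ℝ K z (z - c)) (circleMap c (ρ * Real.exp t) θ)
        (circleMap c (ρ * Real.exp t) θ - c))
  all_goals rw [interior_Iic] at ht
  · exact (hasDerivAt_integral_circleMap_exp hρ (hK.of_le (by norm_num)) ht).hasDerivWithinAt
  · exact (hasDerivAt_integral_circleMap_exp hρ hQ ht).hasDerivWithinAt
  · set R := ρ * Real.exp t with hR
    have hmem (θ : ℝ) : circleMap c R θ ∈ ball c ρ := circleMap_mem_ball_of_neg hρ ht θ
    have hcirc {F : Type} [TopologicalSpace F] {f : ℂ → F} (hf : ContinuousOn f (ball c ρ)) :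
        Continuous fun θ => f (circleMap c R θ) :=
      hf.comp_continuous (continuous_circleMap _ _) hmem
    have hc1 := hcirc (hdK.continuousOn_fderiv_of_isOpen isOpen_ball le_rfl)
    have hc2 := hcirc hdK.continuousOn
    have hc3 : Continuous fun θ => circleMap c R θ - c :=
      (continuous_circleMap _ _).sub continuous_const
    -- `T` is the θ-derivative of DK(iw): as w' = iw, it equals D²K(iw, iw) - DK(w).
    let T (θ : ℝ) : ℝ := fderiv ℝ (fderiv ℝ K) (circleMap c R θ)
      (Complex.I * (circleMap c R θ - c)) (Complex.I * (circleMap c R θ - c))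
      - fderiv ℝ K (circleMap c R θ) (circleMap c R θ - c)
    have hTc : Continuous T := by
      have h4 : Continuous fun θ => Complex.I * (circleMap c R θ - c) := continuous_const.mul hc3
      exact ((hc1.clm_apply h4).clm_apply h4).sub (hc2.clm_apply hc3)
    have hT : ∫ θ in (0 : ℝ)..(2 * Real.pi), T θ = 0 := by
      rw [intervalIntegral.integral_eq_sub_of_hasDerivAt
        (f := fun θ => fderiv ℝ K (circleMap c R θ) (Complex.I * (circleMap c R θ - c)))]
      · have := periodic_circleMap c R 0
        rw [zero_add] at this
        simp only [this, sub_self]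
      · intro θ _
        have hd : HasDerivAt (circleMap c R) (Complex.I * (circleMap c R θ - c)) θ := by
          have := hasDerivAt_circleMap c R θ
          rwa [mul_comm, ← circleMap_sub_center c] at this
        have h1 := (hdQ (hmem θ)).comp_hasDerivAt θ hd
        have h2 : HasDerivAt (fun θ => Complex.I * (circleMap c R θ - c))
          (-(circleMap c R θ - c)) θ := by
          have := (hd.sub_const c).const_mul Complex.I
          rwa [← mul_assoc, Complex.I_mul_I, neg_one_mul] at this
        have h3 := h1.clm_apply h2
        rwa [map_neg, ← sub_eq_add_neg] at h3
      · exact hTc.intervalIntegrable _ _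
    have hSc : Continuous fun θ => fderiv ℝ (fderiv ℝ K) (circleMap c R θ)
        (circleMap c R θ - c) (circleMap c R θ - c)
        + fderiv ℝ K (circleMap c R θ) (circleMap c R θ - c) :=
      ((hc1.clm_apply hc3).clm_apply hc3).add (hc2.clm_apply hc3)
    simp only [hQ' (hmem _)]
    suffices h : 0 ≤ (∫ θ in (0 : ℝ)..(2 * Real.pi), (fderiv ℝ (fderiv ℝ K) (circleMap c R θ)
        (circleMap c R θ - c) (circleMap c R θ - c)
        + fderiv ℝ K (circleMap c R θ) (circleMap c R θ - c)))
        + ∫ θ in (0 : ℝ)..(2 * Real.pi), T θ by rwa [hT, add_zero] at h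
    rw [← intervalIntegral.integral_add (hSc.intervalIntegrable _ _) (hTc.intervalIntegrable _ _)]
    refine intervalIntegral.integral_nonneg (by positivity) fun θ _ => ?_
    have h5 := planeLaplacian_rotate
      ((hK.contDiffAt (isOpen_ball.mem_nhds (hmem θ)))) (circleMap c R θ - c)
    have h6 : 0 ≤ ‖circleMap c R θ - c‖ ^ 2 * planeLaplacian K (circleMap c R θ) :=
      mul_nonneg (by positivity) (hlap _ (hmem θ))
    simp only [T]
    linarith

/-- The integral of a continuous function over concentric circles is continuous in the radius,
up to the radius zero. -/
theorem continuousOn_integral_circleMap {K : ℂ → ℝ} {c : ℂ} {ρ : ℝ} (hρ : 0 < ρ)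
    (hK : ContinuousOn K (closedBall c ρ)) :
    ContinuousOn (fun r => ∫ θ in (0 : ℝ)..(2 * Real.pi), K (circleMap c r θ)) (Icc 0 ρ) := by
  -- Clamping the radius to [0, ρ] makes the integrand continuous for all real r.
  have hcl : Continuous fun r : ℝ => max 0 (min r ρ) :=
    continuous_const.max (continuous_id.min continuous_const)
  have hcm : Continuous fun p : ℝ × ℝ => circleMap c (max 0 (min p.1 ρ)) p.2 := by
    unfold circleMap
    fun_prop
  have h : Continuous fun r : ℝ => ∫ θ in (0 : ℝ)..(2 * Real.pi),
      K (circleMap c (max 0 (min r ρ)) θ) := by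
    refine intervalIntegral.continuous_parametric_intervalIntegral_of_continuous' ?_ _ _
    refine hK.comp_continuous hcm fun p => ?_
    exact closedBall_subset_closedBall (max_le hρ.le (min_le_right _ _))
      (circleMap_mem_closedBall c (le_max_left _ _) _)
  refine h.continuousOn.congr fun r hr => ?_
  simp only [min_eq_left hr.2, max_eq_right hr.1]

/-- A strict decrease between two points would force the function, by convexity, above a line
growing without bound towards -∞. -/
theorem ConvexOn.monotoneOn_Iic_of_bddAbove {ψ : ℝ → ℝ} {a C : ℝ} (h : ConvexOn ℝ (Iic a) ψ)
    (hC : ∀ t ∈ Iic a, ψ t ≤ C) : MonotoneOn ψ (Iic a) := by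
  intro s hs t ht hst
  by_contra! hlt
  have hst' : s < t := lt_of_le_of_ne hst (by rintro rfl; exact lt_irrefl _ hlt)
  have hd : 0 < ψ s - ψ t := by linarith
  -- The secant line through s and t takes the value ψ s + |C - ψ s| + 1 > C at this x.
  set x := s - (|C - ψ s| + 1) * (t - s) / (ψ s - ψ t) with hx
  have hxs : x < s := by
    have : 0 < (|C - ψ s| + 1) * (t - s) / (ψ s - ψ t) :=
      div_pos (mul_pos (by positivity) (by linarith)) hd
    linarith
  have h1 := h.slope_mono_adjacent (show x ∈ Iic a from hxs.le.trans hs) ht hxs hst'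
  have h2 := hC x (hxs.le.trans hs)
  rw [div_le_div_iff₀ (by linarith) (by linarith)] at h1
  have h3 : (s - x) * (ψ s - ψ t) = (|C - ψ s| + 1) * (t - s) := by
    rw [hx]; field_simp; ring
  have h4 : (|C - ψ s| + 1) * (t - s) ≤ (ψ x - ψ s) * (t - s) := by nlinarith
  have h5 := le_of_mul_le_mul_right h4 (by linarith)
  have h6 := le_abs_self (C - ψ s)
  linarith

/-- The circle means of a `C²` function with nonnegative Laplacian: convexity in the logarithm of
the radius, monotonicity, and the inequality with the value at the centre. -/
theorem circle_integrals_of_planeLaplacian_nonneg {K : ℂ → ℝ} {c : ℂ} {ρ : ℝ} (hρ : 0 < ρ)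
    (hKc : ContinuousOn K (closedBall c ρ)) (hK : ContDiffOn ℝ 2 K (ball c ρ))
    (hlap : ∀ z ∈ ball c ρ, 0 ≤ planeLaplacian K z) :
    ConvexOn ℝ (Iic 0)
      (fun t => ∫ θ in (0 : ℝ)..(2 * Real.pi), K (circleMap c (ρ * Real.exp t) θ)) ∧
    MonotoneOn
      (fun t => ∫ θ in (0 : ℝ)..(2 * Real.pi), K (circleMap c (ρ * Real.exp t) θ)) (Iic 0) ∧
    2 * Real.pi * K c ≤ ∫ θ in (0 : ℝ)..(2 * Real.pi), K (circleMap c ρ θ) := by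
  have hI := continuousOn_integral_circleMap hρ hKc
  have hmaps : MapsTo (fun t => ρ * Real.exp t) (Iic 0) (Icc 0 ρ) := fun t ht =>
    ⟨by positivity, mul_le_of_le_one_right hρ.le (Real.exp_le_one_iff.2 ht)⟩
  have hexp : Continuous fun t => ρ * Real.exp t := continuous_const.mul Real.continuous_exp
  have hcont := hI.comp hexp.continuousOn hmaps
  have hconv := convexOn_integral_circleMap_exp hρ hK hlap hcont
  obtain ⟨C, hC⟩ := isCompact_Icc.exists_bound_of_continuousOn hI
  have hmono := hconv.monotoneOn_Iic_of_bddAbove (C := C)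
    fun t ht => (le_abs_self _).trans (hC _ (hmaps ht))
  refine ⟨hconv, hmono, ?_⟩
  -- The centre is reached as t → -∞, where the circle integral tends to 2π K(c).
  have hlim : Tendsto (fun t => ρ * Real.exp t) atBot (𝓝[Icc 0 ρ] 0) := by
    refine tendsto_nhdsWithin_iff.2 ⟨?_, ?_⟩
    · simpa using Real.tendsto_exp_atBot.const_mul ρ
    · filter_upwards [Iic_mem_atBot 0] with t ht using hmaps ht
  have h0 : Tendsto (fun t => ∫ θ in (0 : ℝ)..(2 * Real.pi), K (circleMap c (ρ * Real.exp t) θ))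
      atBot (𝓝 (2 * Real.pi * K c)) := by
    have := (hI 0 ⟨le_rfl, hρ.le⟩).tendsto.comp hlim
    simpa [circleMap_zero_radius, Function.comp_def] using this
  refine le_of_tendsto h0 ?_
  filter_upwards [Iic_mem_atBot 0] with t ht
  simpa using hmono ht (self_mem_Iic : (0 : ℝ) ∈ Iic 0) ht

end CircleMeans

/-! ### From |∇F|² ≤ F ΔF to circle integrals of √F. -/

section LogSubharmonic

open MeasureTheory Metric Set Filter Topology

theorem ContDiffAt.eventually_differentiableAt {V W : Type*} [NormedAddCommGroup V]
    [NormedSpace ℝ V] [NormedAddCommGroup W] [NormedSpace ℝ W] {A : V → W} {z : V}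
    (hA : ContDiffAt ℝ 2 A z) : ∀ᶠ x in 𝓝 z, DifferentiableAt ℝ A x := by
  filter_upwards [hA.eventually (by simp)] with x hx using hx.differentiableAt (by simp)

theorem ContDiffAt.differentiableAt_fderiv {V W : Type*} [NormedAddCommGroup V]
    [NormedSpace ℝ V] [NormedAddCommGroup W] [NormedSpace ℝ W] {A : V → W} {z : V}
    (hA : ContDiffAt ℝ 2 A z) : DifferentiableAt ℝ (fderiv ℝ A) z :=
  (hA.fderiv_right (m := 1) (by norm_num)).differentiableAt (by simp)

theorem fderiv_fderiv_mul {A B : ℂ → ℝ} {z : ℂ} (hA : ContDiffAt ℝ 2 A z)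
    (hB : ContDiffAt ℝ 2 B z) (v : ℂ) :
    fderiv ℝ (fderiv ℝ (fun x => A x * B x)) z v v
      = A z * fderiv ℝ (fderiv ℝ B) z v v + 2 * (fderiv ℝ A z v * fderiv ℝ B z v)
        + B z * fderiv ℝ (fderiv ℝ A) z v v := by
  have h1 : fderiv ℝ (fun x => A x * B x) =ᶠ[𝓝 z]
      fun x => A x • fderiv ℝ B x + B x • fderiv ℝ A x := by
    filter_upwards [hA.eventually_differentiableAt, hB.eventually_differentiableAt] with x hx hy
    exact fderiv_fun_mul hx hy
  have hA1 := (hA.differentiableAt (by simp)).hasFDerivAt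
  have hB1 := (hB.differentiableAt (by simp)).hasFDerivAt
  have h2 := ((hA1.smul hB.differentiableAt_fderiv.hasFDerivAt).add
    (hB1.smul hA.differentiableAt_fderiv.hasFDerivAt)).congr_of_eventuallyEq h1
  rw [h2.fderiv]
  simp
  ring

theorem planeLaplacian_mul {A B : ℂ → ℝ} {z : ℂ} (hA : ContDiffAt ℝ 2 A z)
    (hB : ContDiffAt ℝ 2 B z) :
    planeLaplacian (fun x => A x * B x) z = A z * planeLaplacian B z
      + 2 * (fderiv ℝ A z 1 * fderiv ℝ B z 1 + fderiv ℝ A z Complex.I * fderiv ℝ B z Complex.I)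
      + B z * planeLaplacian A z := by
  simp only [planeLaplacian, fderiv_fderiv_mul hA hB]
  ring

/-- On the line through z along v, a negative second derivative would make the local minimum a local
maximum as well. The function would then be constant near 0 on that line, with zero second
derivative. -/
theorem fderiv_fderiv_nonneg_of_isLocalMin {F : ℂ → ℝ} {z : ℂ} (hF : ContDiffAt ℝ 2 F z)
    (hmin : IsLocalMin F z) (v : ℂ) : 0 ≤ fderiv ℝ (fderiv ℝ F) z v v := by
  have hline (s : ℝ) : HasDerivAt (fun s : ℝ => z + s • v) v s := by
    simpa using ((hasDerivAt_id s).smul_const v).const_add z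
  have hcont : Tendsto (fun s : ℝ => z + s • v) (𝓝 0) (𝓝 z) := by
    simpa using (hline 0).continuousAt.tendsto
  have h1 : deriv (fun s : ℝ => F (z + s • v)) =ᶠ[𝓝 0] fun s => fderiv ℝ F (z + s • v) v := by
    filter_upwards [hcont.eventually hF.eventually_differentiableAt] with s hs
    exact (hs.hasFDerivAt.comp_hasDerivAt s (hline s)).deriv
  have h2 : HasDerivAt (fun s : ℝ => fderiv ℝ F (z + s • v) v) (fderiv ℝ (fderiv ℝ F) z v v) 0 := by
    have h3 : HasFDerivAt (fun y => fderiv ℝ F y v)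
        ((ContinuousLinearMap.apply ℝ ℝ v).comp (fderiv ℝ (fderiv ℝ F) z)) (z + (0 : ℝ) • v) := by
      rw [zero_smul, add_zero]
      exact (ContinuousLinearMap.apply ℝ ℝ v).hasFDerivAt.comp z
        hF.differentiableAt_fderiv.hasFDerivAt
    exact h3.comp_hasDerivAt (0 : ℝ) (hline 0)
  have h4 := (h2.congr_of_eventuallyEq h1).deriv
  have h5 : ∀ᶠ s in 𝓝 (0 : ℝ), F (z + (0 : ℝ) • v) ≤ F (z + s • v) := by
    simpa using hcont.eventually hmin
  have hmin' : IsLocalMin (fun s : ℝ => F (z + s • v)) 0 := h5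
  by_contra! hneg
  have hmax : IsLocalMax (fun s : ℝ => F (z + s • v)) 0 := by
    refine isLocalMax_of_deriv_deriv_neg (by rwa [h4]) hmin'.deriv_eq_zero ?_
    have : ContinuousAt F (z + (0 : ℝ) • v) := by simpa using hF.continuousAt
    exact this.comp (f := fun s : ℝ => z + s • v) (hline 0).continuousAt
  have hconst : (fun s : ℝ => F (z + s • v)) =ᶠ[𝓝 0] fun _ => F z := by
    filter_upwards [hmin', hmax] with s h6 h7
    simp only [zero_smul, add_zero] at h6 h7
    exact le_antisymm h7 h6
  have h8 := hconst.deriv.deriv_eq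
  rw [h4] at h8
  simp at h8
  linarith

/-- For h = √(F + ε²), differentiating h² = F + ε² gives ∇F = 2h∇h and ΔF = 2hΔh + 2|∇h|². So the
claim amounts to 2|∇h|² ≤ ΔF. -/
theorem planeLaplacian_sqrt_nonneg {F : ℂ → ℝ} {z : ℂ} {ε : ℝ} (hε : ε ≠ 0)
    (hF : ContDiffAt ℝ 2 F z) (hpos : ∀ x, 0 ≤ F x)
    (hlog : 0 < F z → (fderiv ℝ F z 1) ^ 2 + (fderiv ℝ F z Complex.I) ^ 2
      ≤ F z * planeLaplacian F z) :
    0 ≤ planeLaplacian (fun x => Real.sqrt (F x + ε ^ 2)) z := by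
  have hε2 : 0 < ε ^ 2 := by positivity
  have hQpos (x : ℂ) : 0 < F x + ε ^ 2 := by linarith [hpos x]
  set h : ℂ → ℝ := fun x => Real.sqrt (F x + ε ^ 2) with hh
  have hhC : ContDiffAt ℝ 2 h z := (hF.add contDiffAt_const).sqrt (hQpos z).ne'
  have hsq : (fun x => h x * h x) = fun x => F x + ε ^ 2 := by
    funext x
    exact Real.mul_self_sqrt (hQpos x).le
  have hfd : fderiv ℝ (fun x => h x * h x) = fderiv ℝ F := by
    rw [hsq]
    funext x
    simp
  have hlap : planeLaplacian F z = 2 * (h z * planeLaplacian h z)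
      + 2 * ((fderiv ℝ h z 1) ^ 2 + (fderiv ℝ h z Complex.I) ^ 2) := by
    have h1 := planeLaplacian_mul hhC hhC
    rw [planeLaplacian, hfd] at h1
    rw [planeLaplacian, h1]
    ring
  have hgrad (v : ℂ) : fderiv ℝ F z v = 2 * (h z * fderiv ℝ h z v) := by
    have hd := hhC.differentiableAt (by simp)
    rw [← hfd, fderiv_fun_mul hd hd]
    simp
    ring
  have hz : 0 < h z := Real.sqrt_pos.2 (hQpos z)
  have hzz : h z * h z = F z + ε ^ 2 := congrFun hsq z
  set G := (fderiv ℝ h z 1) ^ 2 + (fderiv ℝ h z Complex.I) ^ 2 with hG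
  have hG0 : 0 ≤ G := by positivity
  have hgradG : (fderiv ℝ F z 1) ^ 2 + (fderiv ℝ F z Complex.I) ^ 2 = 4 * (h z * h z) * G := by
    rw [hgrad, hgrad, hG]
    ring
  rcases (hpos z).eq_or_lt with h0 | h0
  -- At a zero of F, a global minimum, ∇F = 0 (hence ∇h = 0) and ΔF ≥ 0.
  · have hmin : IsLocalMin F z := Eventually.of_forall fun x => by
      rw [← h0]
      exact hpos x
    have hd0 : fderiv ℝ F z = 0 := hmin.fderiv_eq_zero
    have hl0 : 0 ≤ planeLaplacian F z := add_nonneg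
      (fderiv_fderiv_nonneg_of_isLocalMin hF hmin _) (fderiv_fderiv_nonneg_of_isLocalMin hF hmin _)
    have hG' : G = 0 := by
      rw [hd0] at hgradG
      simpa [hz.ne'] using hgradG
    rw [hG', mul_zero, add_zero] at hlap
    rw [hlap] at hl0
    exact (mul_nonneg_iff_of_pos_left hz).1 (by linarith)
  -- Here 4h²|∇h|² = |∇F|² ≤ F ΔF ≤ h²ΔF, which even yields 4|∇h|² ≤ ΔF.
  · have h1 := hlog h0
    rw [hgradG] at h1
    have h2 : 4 * (h z * h z) * G ≤ (h z * h z) * planeLaplacian F z := by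
      have : 0 ≤ planeLaplacian F z := by
        have : 0 ≤ F z * planeLaplacian F z := le_trans (by positivity) h1
        exact (mul_nonneg_iff_of_pos_left h0).1 this
      nlinarith
    have h3 : 4 * G ≤ planeLaplacian F z :=
      le_of_mul_le_mul_left (by linarith) (mul_pos hz hz)
    exact (mul_nonneg_iff_of_pos_left hz).1 (by linarith)

/-- The circle means of the square root of a nonnegative function whose logarithm is
subharmonic. -/
theorem circle_integrals_sqrt {F : ℂ → ℝ} {c : ℂ} {ρ : ℝ} (hρ : 0 < ρ) (hpos : ∀ x, 0 ≤ F x)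
    (hFc : ContinuousOn F (closedBall c ρ)) (hF : ContDiffOn ℝ 2 F (ball c ρ))
    (hlog : ∀ z ∈ ball c ρ, 0 < F z → (fderiv ℝ F z 1) ^ 2 + (fderiv ℝ F z Complex.I) ^ 2
      ≤ F z * planeLaplacian F z) :
    ConvexOn ℝ (Iic 0)
      (fun t => ∫ θ in (0 : ℝ)..(2 * Real.pi), √(F (circleMap c (ρ * Real.exp t) θ))) ∧
    MonotoneOn
      (fun t => ∫ θ in (0 : ℝ)..(2 * Real.pi), √(F (circleMap c (ρ * Real.exp t) θ))) (Iic 0) ∧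
    2 * Real.pi * √(F c) ≤ ∫ θ in (0 : ℝ)..(2 * Real.pi), √(F (circleMap c ρ θ)) := by
  have key (ε : ℝ) (hε : ε ∈ ({0}ᶜ : Set ℝ)) := circle_integrals_of_planeLaplacian_nonneg
    (K := fun x => √(F x + ε ^ 2)) hρ (hFc.add continuousOn_const).sqrt
    (fun z hz => ((hF.contDiffAt (isOpen_ball.mem_nhds hz)).add contDiffAt_const).sqrt
      (ne_of_gt <| by
          have := hpos z
          have : 0 < ε ^ 2 := sq_pos_of_ne_zero hε
          linarith)
      |>.contDiffWithinAt)
    (fun z hz => planeLaplacian_sqrt_nonneg hε (hF.contDiffAt (isOpen_ball.mem_nhds hz)) hpos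
      (hlog z hz))
  have hlim (t : ℝ) (ht : t ≤ 0) : Tendsto
      (fun ε : ℝ => ∫ θ in (0 : ℝ)..(2 * Real.pi), √(F (circleMap c (ρ * Real.exp t) θ) + ε ^ 2))
      (𝓝[≠] 0) (𝓝 (∫ θ in (0 : ℝ)..(2 * Real.pi), √(F (circleMap c (ρ * Real.exp t) θ)))) := by
    have hc : Continuous fun ε : ℝ => ∫ θ in (0 : ℝ)..(2 * Real.pi),
        √(F (circleMap c (ρ * Real.exp t) θ) + ε ^ 2) := by
      refine intervalIntegral.continuous_parametric_intervalIntegral_of_continuous' ?_ _ _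
      refine Continuous.sqrt (Continuous.add ?_ (by fun_prop))
      exact hFc.comp_continuous ((continuous_circleMap _ _).comp continuous_snd)
        fun p => circleMap_mem_closedBall_of_nonpos hρ ht _
    have := hc.tendsto 0
    simp only [ne_eq, OfNat.ofNat_ne_zero, not_false_eq_true, zero_pow, add_zero] at this
    exact this.mono_left nhdsWithin_le_nhds
  refine ⟨⟨convex_Iic 0, fun s hs t ht a b ha hb hab => ?_⟩, fun s hs t ht hst => ?_, ?_⟩
  · have hst : a • s + b • t ∈ Iic (0 : ℝ) := convex_Iic 0 hs ht ha hb hab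
    refine le_of_tendsto_of_tendsto (hlim _ hst)
      (((hlim s hs).const_smul a).add ((hlim t ht).const_smul b)) ?_
    filter_upwards [self_mem_nhdsWithin] with ε hε using (key ε hε).1.2 hs ht ha hb hab
  · refine le_of_tendsto_of_tendsto (hlim s hs) (hlim t ht) ?_
    filter_upwards [self_mem_nhdsWithin] with ε hε using (key ε hε).2.1 hs ht hst
  · have h0 := hlim 0 le_rfl
    rw [Real.exp_zero, mul_one] at h0
    have hcen : Tendsto (fun ε : ℝ => 2 * Real.pi * √(F c + ε ^ 2)) (𝓝[≠] 0)
        (𝓝 (2 * Real.pi * √(F c))) := by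
      have : Continuous fun ε : ℝ => 2 * Real.pi * √(F c + ε ^ 2) := by fun_prop
      simpa using (this.tendsto 0).mono_left nhdsWithin_le_nhds
    refine le_of_tendsto_of_tendsto hcen h0 ?_
    filter_upwards [self_mem_nhdsWithin] with ε hε using (key ε hε).2.2

/-- A product of nonnegative functions with subharmonic logarithms has a subharmonic logarithm. -/
theorem log_laplacian_mul {A B : ℂ → ℝ} {z : ℂ} (hA : ContDiffAt ℝ 2 A z)
    (hB : ContDiffAt ℝ 2 B z)
    (hlA : (fderiv ℝ A z 1) ^ 2 + (fderiv ℝ A z Complex.I) ^ 2 ≤ A z * planeLaplacian A z)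
    (hlB : (fderiv ℝ B z 1) ^ 2 + (fderiv ℝ B z Complex.I) ^ 2 ≤ B z * planeLaplacian B z) :
    (fderiv ℝ (fun x => A x * B x) z 1) ^ 2 + (fderiv ℝ (fun x => A x * B x) z Complex.I) ^ 2
      ≤ A z * B z * planeLaplacian (fun x => A x * B x) z := by
  rw [planeLaplacian_mul hA hB,
    fderiv_fun_mul (hA.differentiableAt (by simp)) (hB.differentiableAt (by simp))]
  simp only [add_apply, smul_apply, smul_eq_mul]
  nlinarith [mul_le_mul_of_nonneg_left hlA (sq_nonneg (B z)),
    mul_le_mul_of_nonneg_left hlB (sq_nonneg (A z))]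

theorem contDiff_normSq : ContDiff ℝ 2 (fun z : ℂ => ‖z‖ ^ 2) := contDiff_norm_sq ℝ

/-- Both sides equal 4|z|², reflecting that log |z|² is harmonic off the origin; the origin needs no
exception in this form. -/
theorem log_laplacian_normSq (z : ℂ) :
    (fderiv ℝ (fun z : ℂ => ‖z‖ ^ 2) z 1) ^ 2 + (fderiv ℝ (fun z : ℂ => ‖z‖ ^ 2) z Complex.I) ^ 2
      ≤ ‖z‖ ^ 2 * planeLaplacian (fun z : ℂ => ‖z‖ ^ 2) z := by
  have h1 : fderiv ℝ (fun z : ℂ => ‖z‖ ^ 2) = fun z => (2 • innerSL ℝ : ℂ →L[ℝ] ℂ →L[ℝ] ℝ) z := by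
    funext z
    exact (hasStrictFDerivAt_norm_sq z).hasFDerivAt.fderiv
  rw [planeLaplacian, h1, ContinuousLinearMap.fderiv, ← Complex.normSq_eq_norm_sq,
    Complex.normSq_apply]
  have h2 (v w : ℂ) : (innerSL ℝ : ℂ →L[ℝ] ℂ →L[ℝ] ℝ) v w = v.re * w.re + v.im * w.im := by
    change inner ℝ v w = _
    simp [Complex.inner, mul_comm]
  simp only [two_smul, add_apply, h2]
  simp
  nlinarith

end LogSubharmonic

/-! ### Covariant calculus along a map into a plane domain with a metric, and the Bochner
inequality. -/

section Bochner

open Set Filter Topology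

variable {E : Type*} [NormedAddCommGroup E] [NormedSpace ℝ E]

/-- `Γ` is the Levi-Civita connection of the metric `G` on the open subset `Ω` of a vector
space. -/
structure IsLeviCivitaOn (G : E → E →L[ℝ] E →L[ℝ] ℝ) (Γ : E → E →L[ℝ] E →L[ℝ] E)
    (Ω : Set E) : Prop where
  isOpen : IsOpen Ω
  contDiffOn_metric : ContDiffOn ℝ ∞ G Ω
  contDiffOn_connection : ContDiffOn ℝ ∞ Γ Ω
  metric_symm : ∀ y ∈ Ω, ∀ v w, G y v w = G y w v
  metric_pos : ∀ y ∈ Ω, ∀ v, v ≠ 0 → 0 < G y v v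
  torsion_free : ∀ y ∈ Ω, ∀ v w, Γ y v w = Γ y w v
  compat : ∀ y ∈ Ω, ∀ a v w, fderiv ℝ G y a v w = G y (Γ y a v) w + G y v (Γ y a w)

/-- The curvature `R(a, c)x` of the connection `Γ`. -/
noncomputable def connectionCurvature (Γ : E → E →L[ℝ] E →L[ℝ] E) (y a c x : E) : E :=
  fderiv ℝ Γ y a c x - fderiv ℝ Γ y c a x + Γ y a (Γ y c x) - Γ y c (Γ y a x)

/-- The covariant derivative in the direction `v` of a vector field `V` along `f`. -/
noncomputable def covDeriv (Γ : E → E →L[ℝ] E →L[ℝ] E) (f : ℂ → E) (v : ℂ) (V : ℂ → E) (z : ℂ) :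
    E :=
  fderiv ℝ V z v + Γ (f z) (fderiv ℝ f z v) (V z)

variable {G : E → E →L[ℝ] E →L[ℝ] ℝ} {Γ : E → E →L[ℝ] E →L[ℝ] E} {Ω : Set E} {f : ℂ → E}
  {U : Set ℂ}

theorem ContDiffOn.hasFDerivAt_of_isOpen {V W : Type*} [NormedAddCommGroup V]
    [NormedSpace ℝ V] [NormedAddCommGroup W] [NormedSpace ℝ W] {F : V → W} {s : Set V}
    (hF : ContDiffOn ℝ ∞ F s) (hs : IsOpen s) {z : V} (hz : z ∈ s) :
    HasFDerivAt F (fderiv ℝ F z) z :=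
  ((hF.contDiffAt (hs.mem_nhds hz)).differentiableAt (by simp)).hasFDerivAt

theorem ContDiffOn.fderiv_apply_of_isOpen {W : Type*} [NormedAddCommGroup W] [NormedSpace ℝ W]
    {F : ℂ → W} (hU : IsOpen U) (hF : ContDiffOn ℝ ∞ F U) (v : ℂ) :
    ContDiffOn ℝ ∞ (fun z => fderiv ℝ F z v) U :=
  (hF.fderiv_of_isOpen hU (by simp)).clm_apply contDiffOn_const

theorem fderiv_fderiv_apply {W : Type*} [NormedAddCommGroup W] [NormedSpace ℝ W]
    {F : ℂ → W} (hU : IsOpen U) (hF : ContDiffOn ℝ ∞ F U) {z : ℂ} (hz : z ∈ U) (v w : ℂ) :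
    fderiv ℝ (fun z => fderiv ℝ F z w) z v = fderiv ℝ (fderiv ℝ F) z v w := by
  have h1 := (hF.fderiv_of_isOpen (m := ∞) hU (by simp)).hasFDerivAt_of_isOpen hU hz
  have h2 : HasFDerivAt (fun z => fderiv ℝ F z w) _ z := h1.clm_apply (hasFDerivAt_const w z)
  rw [h2.fderiv]
  simp

theorem fderiv_fderiv_apply_comm {W : Type*} [NormedAddCommGroup W] [NormedSpace ℝ W]
    {F : ℂ → W} (hU : IsOpen U) (hF : ContDiffOn ℝ ∞ F U) {z : ℂ} (hz : z ∈ U) (v w : ℂ) :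
    fderiv ℝ (fun z => fderiv ℝ F z w) z v = fderiv ℝ (fun z => fderiv ℝ F z v) z w := by
  rw [fderiv_fderiv_apply hU hF hz, fderiv_fderiv_apply hU hF hz]
  exact ((hF.contDiffAt (hU.mem_nhds hz)).isSymmSndFDerivAt
    (by rw [minSmoothness_of_isRCLikeNormedField]; exact WithTop.coe_le_coe.2 le_top)).eq _ _

namespace IsLeviCivitaOn

theorem contDiffOn_metric_apply (h : IsLeviCivitaOn G Γ Ω) (hf : ContDiffOn ℝ ∞ f U)
    (hfU : MapsTo f U Ω) {V W : ℂ → E} (hV : ContDiffOn ℝ ∞ V U)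
    (hW : ContDiffOn ℝ ∞ W U) : ContDiffOn ℝ ∞ (fun z => G (f z) (V z) (W z)) U :=
  ((h.contDiffOn_metric.comp hf hfU).clm_apply hV).clm_apply hW

variable (h : IsLeviCivitaOn G Γ Ω) (hU : IsOpen U) (hf : ContDiffOn ℝ ∞ f U) (hfU : MapsTo f U Ω)

include h hU hf hfU

theorem contDiffOn_covDeriv {V : ℂ → E} (hV : ContDiffOn ℝ ∞ V U) (v : ℂ) :
    ContDiffOn ℝ ∞ (covDeriv Γ f v V) U :=
  (hV.fderiv_apply_of_isOpen hU v).add (((h.contDiffOn_connection.comp hf hfU).clm_apply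
    (hf.fderiv_apply_of_isOpen hU v)).clm_apply hV)

-- The product rule for the pulled-back connection: metric compatibility combined with the chain
-- rule.
set_option synthInstance.maxHeartbeats 200000 in
theorem fderiv_metric_apply {V W : ℂ → E} (hV : ContDiffOn ℝ ∞ V U)
    (hW : ContDiffOn ℝ ∞ W U) {z : ℂ} (hz : z ∈ U) (v : ℂ) :
    fderiv ℝ (fun z => G (f z) (V z) (W z)) z v
      = G (f z) (covDeriv Γ f v V z) (W z) + G (f z) (V z) (covDeriv Γ f v W z) := by
  have h1 : HasFDerivAt (fun z => G (f z)) ((fderiv ℝ G (f z)).comp (fderiv ℝ f z)) z :=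
    HasFDerivAt.comp z (h.contDiffOn_metric.hasFDerivAt_of_isOpen h.isOpen (hfU hz))
      (hf.hasFDerivAt_of_isOpen hU hz)
  have h2 : HasFDerivAt (fun z => G (f z) (V z) (W z)) _ z :=
    (h1.clm_apply (hV.hasFDerivAt_of_isOpen hU hz)).clm_apply (hW.hasFDerivAt_of_isOpen hU hz)
  rw [h2.fderiv]
  simp [covDeriv, h.compat _ (hfU hz)]
  ring

theorem covDeriv_fderiv_comm {z : ℂ} (hz : z ∈ U) (v w : ℂ) :
    covDeriv Γ f v (fun z => fderiv ℝ f z w) z = covDeriv Γ f w (fun z => fderiv ℝ f z v) z := by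
  rw [covDeriv, covDeriv, fderiv_fderiv_apply_comm hU hf hz, h.torsion_free _ (hfU hz)]

set_option synthInstance.maxHeartbeats 200000 in
theorem fderiv_covDeriv {V : ℂ → E} (hV : ContDiffOn ℝ ∞ V U) {z : ℂ} (hz : z ∈ U) (v w : ℂ) :
    fderiv ℝ (covDeriv Γ f w V) z v = fderiv ℝ (fun z => fderiv ℝ V z w) z v
      + (fderiv ℝ Γ (f z) (fderiv ℝ f z v) (fderiv ℝ f z w) (V z)
        + Γ (f z) (fderiv ℝ (fun z => fderiv ℝ f z w) z v) (V z)
        + Γ (f z) (fderiv ℝ f z w) (fderiv ℝ V z v)) := by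
  have h1 : HasFDerivAt (fun z => Γ (f z)) ((fderiv ℝ Γ (f z)).comp (fderiv ℝ f z)) z :=
    HasFDerivAt.comp z (h.contDiffOn_connection.hasFDerivAt_of_isOpen h.isOpen (hfU hz))
      (hf.hasFDerivAt_of_isOpen hU hz)
  have h2 : HasFDerivAt (fun z => Γ (f z) (fderiv ℝ f z w) (V z)) _ z :=
    (h1.clm_apply ((hf.fderiv_apply_of_isOpen hU w).hasFDerivAt_of_isOpen hU hz)).clm_apply
      (hV.hasFDerivAt_of_isOpen hU hz)
  have h3 : HasFDerivAt (covDeriv Γ f w V) _ z :=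
    ((hV.fderiv_apply_of_isOpen hU w).hasFDerivAt_of_isOpen hU hz).add h2
  rw [h3.fderiv]
  simp
  abel

/-- The second derivatives of V and of f cancel by symmetry; the derivative of Γ and its quadratic
terms are what remains. -/
theorem covDeriv_comm {V : ℂ → E} (hV : ContDiffOn ℝ ∞ V U) {z : ℂ} (hz : z ∈ U) (v w : ℂ) :
    covDeriv Γ f v (covDeriv Γ f w V) z - covDeriv Γ f w (covDeriv Γ f v V) z
      = connectionCurvature Γ (f z) (fderiv ℝ f z v) (fderiv ℝ f z w) (V z) := by
  have hout (v : ℂ) (W : ℂ → E) :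
    covDeriv Γ f v W z = fderiv ℝ W z v + Γ (f z) (fderiv ℝ f z v) (W z) := rfl
  rw [hout v (covDeriv Γ f w V), hout w (covDeriv Γ f v V),
    h.fderiv_covDeriv hU hf hfU hV hz, h.fderiv_covDeriv hU hf hfU hV hz,
    fderiv_fderiv_apply_comm hU hV hz v w, fderiv_fderiv_apply_comm hU hf hz v w]
  simp only [covDeriv, connectionCurvature, map_add]
  abel

/-- The curvature of a metric connection is skew-symmetric. -/
theorem metric_curvature_skew {z : ℂ} (hz : z ∈ U) (v w : ℂ) (x y : E) :
    G (f z) (connectionCurvature Γ (f z) (fderiv ℝ f z v) (fderiv ℝ f z w) x) y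
      = - G (f z) x (connectionCurvature Γ (f z) (fderiv ℝ f z v) (fderiv ℝ f z w) y) := by
  have hc (x : E) : ContDiffOn ℝ ∞ (fun _ : ℂ => x) U := contDiffOn_const
  have hD (x : E) (v : ℂ) := h.contDiffOn_covDeriv hU hf hfU (hc x) v
  have hG := h.contDiffOn_metric_apply hf hfU (hc x) (hc y)
  -- The second derivative of G(x, y) along f, with x and y constant. Its symmetry in v, w cancels
  -- the mixed terms and leaves G(R x, y) + G(x, R y) = 0.
  have key (v w : ℂ) : fderiv ℝ (fun z => fderiv ℝ (fun z => G (f z) x y) z w) z v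
      = (G (f z) (covDeriv Γ f v (covDeriv Γ f w fun _ => x) z) y
        + G (f z) (covDeriv Γ f w (fun _ => x) z) (covDeriv Γ f v (fun _ => y) z))
      + (G (f z) (covDeriv Γ f v (fun _ => x) z) (covDeriv Γ f w (fun _ => y) z)
        + G (f z) x (covDeriv Γ f v (covDeriv Γ f w fun _ => y) z)) := by
    have h1 : (fun z => fderiv ℝ (fun z => G (f z) x y) z w) =ᶠ[𝓝 z]
        fun z => G (f z) (covDeriv Γ f w (fun _ => x) z) y
          + G (f z) x (covDeriv Γ f w (fun _ => y) z) := by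
      filter_upwards [hU.mem_nhds hz] with z' hz'
      exact h.fderiv_metric_apply hU hf hfU (hc x) (hc y) hz' w
    rw [h1.fderiv_eq, fderiv_fun_add
      ((h.contDiffOn_metric_apply hf hfU (hD x w) (hc y)).hasFDerivAt_of_isOpen hU
        hz).differentiableAt
      ((h.contDiffOn_metric_apply hf hfU (hc x) (hD y w)).hasFDerivAt_of_isOpen hU
        hz).differentiableAt, add_apply, h.fderiv_metric_apply hU hf hfU (hD x w) (hc y) hz,
      h.fderiv_metric_apply hU hf hfU (hc x) (hD y w) hz]
  have h2 := fderiv_fderiv_apply_comm hU hG hz v w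
  rw [key v w, key w v] at h2
  rw [← h.covDeriv_comm hU hf hfU (hc x) hz, ← h.covDeriv_comm hU hf hfU (hc y) hz, map_sub,
    map_sub, sub_apply]
  linarith

end IsLeviCivitaOn

/-- In a plane, a vector orthogonal to two nonzero orthogonal vectors is zero. -/
theorem eq_zero_of_orthogonal_pair (hE : Module.finrank ℝ E = 2) {B : E →L[ℝ] E →L[ℝ] ℝ}
    (hpos : ∀ v, v ≠ 0 → 0 < B v v) {a c n : E} (hsymm : ∀ v w, B v w = B w v)
    (ha : B a a ≠ 0) (hc : B c c ≠ 0) (hac : B a c = 0) (hna : B n a = 0) (hnc : B n c = 0) :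
    n = 0 := by
  have hli : LinearIndependent ℝ ![a, c] := by
    rw [LinearIndependent.pair_iff]
    intro s t hst
    have h1 : B (s • a + t • c) a = 0 := by rw [hst]; simp
    have h2 : B (s • a + t • c) c = 0 := by rw [hst]; simp
    simp [hsymm c a, hac, ha] at h1
    simp [hac, hc] at h2
    exact ⟨h1, h2⟩
  have hspan := hli.span_eq_top_of_card_eq_finrank (by simp [hE])
  have hn : n ∈ Submodule.span ℝ (Set.range ![a, c]) := by rw [hspan]; trivial
  rw [Matrix.range_cons, Matrix.range_cons, Matrix.range_empty, Set.union_empty,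
    Set.singleton_union, Submodule.mem_span_pair] at hn
  obtain ⟨s, t, hst⟩ := hn
  by_contra hne
  have h3 := hpos n hne
  nth_rewrite 2 [← hst] at h3
  simp [hna, hnc] at h3

/-- Parseval's identity for an orthogonal pair of vectors of the same length in a plane. -/
theorem parseval_orthogonal_pair (hE : Module.finrank ℝ E = 2) {B : E →L[ℝ] E →L[ℝ] ℝ}
    (hpos : ∀ v, v ≠ 0 → 0 < B v v) {a c : E} (hsymm : ∀ v w, B v w = B w v)
    (ha : B a a ≠ 0) (hc : B c c = B a a) (hac : B a c = 0) (p : E) :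
    B a a * B p p = (B p a) ^ 2 + (B p c) ^ 2 := by
  -- p minus its projection on the pair, multiplied by B(a, a) to avoid division.
  have hn := eq_zero_of_orthogonal_pair hE hpos (a := a) (c := c)
    (n := B a a • p - (B p a • a + B p c • c)) hsymm ha (by rwa [hc]) hac
    (by simp [hsymm c a, hac]; ring) (by simp [hac, hc]; ring)
  have h1 : B (B a a • p - (B p a • a + B p c • c)) p = 0 := by rw [hn]; simp
  simp [hsymm a p, hsymm c p] at h1
  linarith

namespace IsLeviCivitaOn

variable (h : IsLeviCivitaOn G Γ Ω) (hU : IsOpen U) (hf : ContDiffOn ℝ ∞ f U) (hfU : MapsTo f U Ω)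

include h hU hf hfU

/-- A conformal immersion of a plane domain into a surface is harmonic. -/
theorem covDeriv_add_covDeriv_eq_zero (hE : Module.finrank ℝ E = 2)
    (hconf : ∀ z ∈ U, G (f z) (fderiv ℝ f z 1) (fderiv ℝ f z 1)
      = G (f z) (fderiv ℝ f z Complex.I) (fderiv ℝ f z Complex.I))
    (horth : ∀ z ∈ U, G (f z) (fderiv ℝ f z 1) (fderiv ℝ f z Complex.I) = 0)
    {z : ℂ} (hz : z ∈ U) (hne : G (f z) (fderiv ℝ f z 1) (fderiv ℝ f z 1) ≠ 0) :
    covDeriv Γ f 1 (fun z => fderiv ℝ f z 1) z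
      + covDeriv Γ f Complex.I (fun z => fderiv ℝ f z Complex.I) z = 0 := by
  have ha := hf.fderiv_apply_of_isOpen hU 1
  have hc := hf.fderiv_apply_of_isOpen hU Complex.I
  have hconf' : (fun z => G (f z) (fderiv ℝ f z 1) (fderiv ℝ f z 1)) =ᶠ[𝓝 z]
      fun z => G (f z) (fderiv ℝ f z Complex.I) (fderiv ℝ f z Complex.I) := by
    filter_upwards [hU.mem_nhds hz] with x hx using hconf x hx
  have horth' : (fun z => G (f z) (fderiv ℝ f z 1) (fderiv ℝ f z Complex.I)) =ᶠ[𝓝 z]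
      fun _ => 0 := by
    filter_upwards [hU.mem_nhds hz] with x hx using horth x hx
  have h1 (v : ℂ) : fderiv ℝ (fun z => G (f z) (fderiv ℝ f z 1) (fderiv ℝ f z 1)) z v
      = fderiv ℝ (fun z => G (f z) (fderiv ℝ f z Complex.I) (fderiv ℝ f z Complex.I)) z v := by
    rw [hconf'.fderiv_eq]
  have h2 (v : ℂ) : fderiv ℝ (fun z => G (f z) (fderiv ℝ f z 1) (fderiv ℝ f z Complex.I)) z v
      = fderiv ℝ (fun _ : ℂ => (0 : ℝ)) z v := by
    rw [horth'.fderiv_eq]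
  simp only [h.fderiv_metric_apply hU hf hfU ha ha hz, h.fderiv_metric_apply hU hf hfU hc hc hz]
    at h1
  simp only [h.fderiv_metric_apply hU hf hfU ha hc hz, fderiv_fun_const, Pi.zero_apply,
    zero_apply] at h2
  have hs := h.metric_symm _ (hfU hz)
  have ht := h.covDeriv_fderiv_comm hU hf hfU hz 1 Complex.I
  -- With a = f_x and c = f_y, the derivatives of |a|² = |c|² and ⟨a, c⟩ = 0, together with D_x c =
  -- D_y a, make D_x a + D_y c orthogonal to both a and c.
  have h11 := h1 1
  have h1I := h1 Complex.I
  have h21 := h2 1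
  have h2I := h2 Complex.I
  rw [ht] at h11 h21
  rw [hs (fderiv ℝ f z 1)] at h11 h1I h21 h2I
  rw [hs (fderiv ℝ f z Complex.I)] at h11 h1I
  refine eq_zero_of_orthogonal_pair hE (h.metric_pos _ (hfU hz)) hs hne (hconf z hz ▸ hne)
    (horth z hz) ?_ ?_
  · rw [map_add, add_apply]
    linarith
  · rw [map_add, add_apply]
    linarith

/-- The energy density of a conformal immersion into a surface of nonpositive curvature has
a subharmonic logarithm. -/
theorem log_laplacian_energy (hE : Module.finrank ℝ E = 2)
    (hconf : ∀ z ∈ U, G (f z) (fderiv ℝ f z 1) (fderiv ℝ f z 1)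
      = G (f z) (fderiv ℝ f z Complex.I) (fderiv ℝ f z Complex.I))
    (horth : ∀ z ∈ U, G (f z) (fderiv ℝ f z 1) (fderiv ℝ f z Complex.I) = 0)
    (hpos : ∀ z ∈ U, 0 < G (f z) (fderiv ℝ f z 1) (fderiv ℝ f z 1))
    {z : ℂ} (hz : z ∈ U)
    (hR : G (f z) (connectionCurvature Γ (f z) (fderiv ℝ f z 1) (fderiv ℝ f z Complex.I)
      (fderiv ℝ f z Complex.I)) (fderiv ℝ f z 1) ≤ 0) :
    (fderiv ℝ (fun z => G (f z) (fderiv ℝ f z 1) (fderiv ℝ f z 1)) z 1) ^ 2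
      + (fderiv ℝ (fun z => G (f z) (fderiv ℝ f z 1) (fderiv ℝ f z 1)) z Complex.I) ^ 2
      ≤ G (f z) (fderiv ℝ f z 1) (fderiv ℝ f z 1)
        * planeLaplacian (fun z => G (f z) (fderiv ℝ f z 1) (fderiv ℝ f z 1)) z := by
  have ha := hf.fderiv_apply_of_isOpen hU 1
  have hc := hf.fderiv_apply_of_isOpen hU Complex.I
  have hB := h.contDiffOn_metric_apply hf hfU ha ha
  have hda (v : ℂ) := h.contDiffOn_covDeriv hU hf hfU ha v
  have hs := h.metric_symm _ (hfU hz)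
  have hfd {x : ℂ} (hx : x ∈ U) (v : ℂ) :
      fderiv ℝ (fun z => G (f z) (fderiv ℝ f z 1) (fderiv ℝ f z 1)) x v
        = 2 * G (f x) (covDeriv Γ f v (fun z => fderiv ℝ f z 1) x) (fderiv ℝ f x 1) := by
    rw [h.fderiv_metric_apply hU hf hfU ha ha hx, h.metric_symm _ (hfU hx) (fderiv ℝ f x 1)]
    ring
  have hfd2 (v : ℂ) :
      fderiv ℝ (fderiv ℝ (fun z => G (f z) (fderiv ℝ f z 1) (fderiv ℝ f z 1))) z v v
        = 2 * (G (f z) (covDeriv Γ f v (covDeriv Γ f v (fun z => fderiv ℝ f z 1)) z)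
            (fderiv ℝ f z 1)
          + G (f z) (covDeriv Γ f v (fun z => fderiv ℝ f z 1) z)
            (covDeriv Γ f v (fun z => fderiv ℝ f z 1) z)) := by
    have h1 : (fun z => fderiv ℝ (fun z => G (f z) (fderiv ℝ f z 1) (fderiv ℝ f z 1)) z v) =ᶠ[𝓝 z]
        fun x => 2 * G (f x) (covDeriv Γ f v (fun z => fderiv ℝ f z 1) x) (fderiv ℝ f x 1) := by
      filter_upwards [hU.mem_nhds hz] with x hx using hfd hx v
    rw [← fderiv_fderiv_apply hU hB hz, h1.fderiv_eq, fderiv_const_mul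
      ((h.contDiffOn_metric_apply hf hfU (hda v) ha).hasFDerivAt_of_isOpen hU
        hz).differentiableAt, smul_apply, h.fderiv_metric_apply hU hf hfU (hda v) ha hz,
      smul_eq_mul]
  have hharm {x : ℂ} (hx : x ∈ U) : covDeriv Γ f Complex.I (fun z => fderiv ℝ f z Complex.I) x
      = - covDeriv Γ f 1 (fun z => fderiv ℝ f z 1) x :=
    eq_neg_of_add_eq_zero_right
      (h.covDeriv_add_covDeriv_eq_zero hU hf hfU hE hconf horth hx (hpos x hx).ne')
  have hcongr {V W : ℂ → E} (hVW : ∀ x ∈ U, V x = W x) (v : ℂ) :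
      covDeriv Γ f v V z = covDeriv Γ f v W z := by
    have : V =ᶠ[𝓝 z] W := by filter_upwards [hU.mem_nhds hz] with x hx using hVW x hx
    rw [covDeriv, covDeriv, this.fderiv_eq, hVW z hz]
  -- D_y D_y a = D_y D_x c = D_x D_y c - R(a,c)c, and D_y c = -D_x a by harmonicity. Thus the
  -- third-order terms of the Laplacian cancel.
  have hII : covDeriv Γ f Complex.I (covDeriv Γ f Complex.I (fun z => fderiv ℝ f z 1)) z
      = - covDeriv Γ f 1 (covDeriv Γ f 1 (fun z => fderiv ℝ f z 1)) z
        - connectionCurvature Γ (f z) (fderiv ℝ f z 1) (fderiv ℝ f z Complex.I)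
          (fderiv ℝ f z Complex.I) := by
    have h1 := h.covDeriv_comm hU hf hfU hc hz 1 Complex.I
    have h2 : covDeriv Γ f 1 (covDeriv Γ f Complex.I (fun z => fderiv ℝ f z Complex.I)) z
        = - covDeriv Γ f 1 (covDeriv Γ f 1 (fun z => fderiv ℝ f z 1)) z := by
      rw [hcongr (W := fun x => - covDeriv Γ f 1 (fun z => fderiv ℝ f z 1) x)
        (fun x hx => hharm hx), covDeriv, fderiv_fun_neg, neg_apply, map_neg, ← neg_add]
      rfl
    rw [hcongr (fun x hx => h.covDeriv_fderiv_comm hU hf hfU hx Complex.I 1), ← h1, h2]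
    abel
  -- With p = D_x a and q = D_y a one has ⟨q,c⟩ = ⟨p,a⟩ and ⟨p,c⟩ = -⟨q,a⟩, so Parseval gives B|p|²
  -- = B|q|² = |∇B|²/4 for B = |a|².
  have hpars (p : E) := parseval_orthogonal_pair hE (h.metric_pos _ (hfU hz)) hs (hpos z hz).ne'
    (hconf z hz).symm (horth z hz) p
  have hconf' : (fun z => G (f z) (fderiv ℝ f z 1) (fderiv ℝ f z 1)) =ᶠ[𝓝 z]
      fun z => G (f z) (fderiv ℝ f z Complex.I) (fderiv ℝ f z Complex.I) := by
    filter_upwards [hU.mem_nhds hz] with x hx using hconf x hx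
  have horth' : (fun z => G (f z) (fderiv ℝ f z 1) (fderiv ℝ f z Complex.I)) =ᶠ[𝓝 z]
      fun _ => 0 := by
    filter_upwards [hU.mem_nhds hz] with x hx using horth x hx
  have ht := h.covDeriv_fderiv_comm hU hf hfU hz 1 Complex.I
  have hqc : G (f z) (covDeriv Γ f Complex.I (fun z => fderiv ℝ f z 1) z) (fderiv ℝ f z Complex.I)
      = G (f z) (covDeriv Γ f 1 (fun z => fderiv ℝ f z 1) z) (fderiv ℝ f z 1) := by
    have h1 := congrArg (fun L : ℂ →L[ℝ] ℝ => L 1) (hconf'.fderiv_eq (𝕜 := ℝ))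
    rw [hfd hz, h.fderiv_metric_apply hU hf hfU hc hc hz, ht, hs (fderiv ℝ f z Complex.I)] at h1
    linarith
  have hpc : G (f z) (covDeriv Γ f 1 (fun z => fderiv ℝ f z 1) z) (fderiv ℝ f z Complex.I)
      = - G (f z) (covDeriv Γ f Complex.I (fun z => fderiv ℝ f z 1) z) (fderiv ℝ f z 1) := by
    have h1 := congrArg (fun L : ℂ →L[ℝ] ℝ => L 1) (horth'.fderiv_eq (𝕜 := ℝ))
    rw [h.fderiv_metric_apply hU hf hfU ha hc hz, ht, hs (fderiv ℝ f z 1)] at h1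
    simp at h1
    linarith
  have hp1 := hpars (covDeriv Γ f 1 (fun z => fderiv ℝ f z 1) z)
  have hpI := hpars (covDeriv Γ f Complex.I (fun z => fderiv ℝ f z 1) z)
  rw [hpc] at hp1
  rw [hqc] at hpI
  have hRB := mul_nonneg (hpos z hz).le (neg_nonneg.2 hR)
  rw [planeLaplacian, hfd2, hfd2, hII, hfd hz, hfd hz]
  simp only [map_sub, map_neg, sub_apply, neg_apply]
  nlinarith

end IsLeviCivitaOn

end Bochner

set_option synthInstance.maxHeartbeats 200000 in
theorem fderiv_clm_apply₂ {E F : Type*} [NormedAddCommGroup E] [NormedSpace ℝ E]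
    [NormedAddCommGroup F] [NormedSpace ℝ F]
    {B : E → E →L[ℝ] E →L[ℝ] F} {y : E} (hB : DifferentiableAt ℝ B y) (a v w : E) :
    fderiv ℝ B y a v w = fderiv ℝ (fun x => B x v w) y a := by
  have h : HasFDerivAt (fun x => B x v w) _ y :=
    (hB.hasFDerivAt.clm_apply (hasFDerivAt_const v y)).clm_apply (hasFDerivAt_const w y)
  rw [h.fderiv]
  simp

/-! ### Smoothness of the metric coefficients in a chart. -/

section ChartMetric

open Set Filter Topology

variable {E : Type*} [NormedAddCommGroup E] [NormedSpace ℝ E]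
  {S : Type*} [TopologicalSpace S] [ChartedSpace E S] [IsManifold 𝓘(ℝ, E) ∞ S]
  (g : SmoothMetric E S) (b : Module.Basis (Fin 2) ℝ E) {e : OpenPartialHomeomorph S E}

/-- The coordinate field is the tangent map of `e.symm` applied to a constant section. -/
theorem contMDiffOn_coordVector (he : e ∈ atlas E S) (i : Fin 2) :
    ContMDiffOn 𝓘(ℝ, E) (𝓘(ℝ, E).prod 𝓘(ℝ, E)) ∞
      (fun y => TotalSpace.mk' E (E := fun p : S => TangentSpace 𝓘(ℝ, E) p) (e.symm y)
        (coordVector b e i y)) e.target := by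
  have h1 : ContMDiffOn 𝓘(ℝ, E) 𝓘(ℝ, E) ∞ e.symm e.target :=
    contMDiffOn_symm_of_mem_maximalAtlas (IsManifold.subset_maximalAtlas he)
  have h2 := h1.contMDiffOn_tangentMapWithin (m := ∞) (by simp) e.open_target.uniqueMDiffOn
  have h3 : ContMDiffOn 𝓘(ℝ, E) (𝓘(ℝ, E).prod 𝓘(ℝ, E)) ∞
      (fun y : E => TotalSpace.mk' E (E := fun p : E => TangentSpace 𝓘(ℝ, E) p) y (b i))
      e.target :=
    contMDiffOn_vectorSpace_iff_contDiffOn.2 contDiffOn_const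
  refine (h2.comp h3 fun y hy => hy).congr fun y hy => ?_
  simp only [Function.comp_apply, tangentMapWithin, coordVector]
  rw [mfderivWithin_of_isOpen e.open_target hy]

theorem contDiffOn_metricMatrix (he : e ∈ atlas E S) (i j : Fin 2) :
    ContDiffOn ℝ ∞ (fun y => metricMatrix g b e y i j) e.target := by
  rw [← contMDiffOn_iff_contDiffOn]
  have h1 : ContMDiffOn 𝓘(ℝ, E) 𝓘(ℝ, E) ∞ e.symm e.target :=
    contMDiffOn_symm_of_mem_maximalAtlas (IsManifold.subset_maximalAtlas he)
  have h2 := g.contMDiff.comp_contMDiffOn h1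
  intro y hy
  have h3 := ContMDiffWithinAt.clm_bundle_apply₂ (F₁ := E) (F₂ := E) (F₃ := ℝ)
    (E₃ := Bundle.Trivial S ℝ) (h2 y hy)
    (contMDiffOn_coordVector b he i y hy) (contMDiffOn_coordVector b he j y hy)
  simp only [contMDiffWithinAt_totalSpace] at h3
  exact h3.2

end ChartMetric

/-! ### The Christoffel symbols as a Levi-Civita connection on the chart domain. -/

section ChartConnection

set_option synthInstance.maxHeartbeats 200000

open Set Filter Topology

variable {E : Type*} [NormedAddCommGroup E] [NormedSpace ℝ E] [FiniteDimensional ℝ E]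
  {S : Type*} [TopologicalSpace S] [ChartedSpace E S] [IsManifold 𝓘(ℝ, E) ∞ S]
  (g : SmoothMetric E S) (b : Module.Basis (Fin 2) ℝ E) {e : OpenPartialHomeomorph S E}

/-- The linear coordinates of a plane, as continuous linear forms. -/
noncomputable def coordForm (i : Fin 2) : E →L[ℝ] ℝ := (b.coord i).toContinuousLinearMap

@[simp] theorem coordForm_basis (i j : Fin 2) : coordForm b i (b j) = if j = i then 1 else 0 := by
  simp [coordForm, Finsupp.single_apply]

theorem eq_coordForm_smul (v : E) : v = coordForm b 0 v • b 0 + coordForm b 1 v • b 1 := by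
  have := b.sum_repr v
  rw [Fin.sum_univ_two] at this
  exact this.symm

/-- The metric, read in the chart `e`, as a bilinear form on the model plane. -/
noncomputable def metricForm (e : OpenPartialHomeomorph S E) (y : E) : E →L[ℝ] E →L[ℝ] ℝ :=
  ∑ i, ∑ j, metricMatrix g b e y i j • (coordForm b i).smulRight (coordForm b j)

/-- The Christoffel symbols of the chart `e`, as a bilinear map on the model plane. -/
noncomputable def christoffelForm (e : OpenPartialHomeomorph S E) (y : E) :
    E →L[ℝ] E →L[ℝ] E :=
  ∑ k, ∑ i, ∑ j, christoffel g b e k i j y •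
    (coordForm b i).smulRight ((coordForm b j).smulRight (b k))

theorem metricForm_apply (e : OpenPartialHomeomorph S E) (y v w : E) :
    metricForm g b e y v w
      = ∑ i, ∑ j, metricMatrix g b e y i j * (coordForm b i v * coordForm b j w) := by
  simp [metricForm, Fin.sum_univ_two]

theorem christoffelForm_apply (e : OpenPartialHomeomorph S E) (y v w : E) :
    christoffelForm g b e y v w = ∑ k, (∑ i, ∑ j, christoffel g b e k i j y *
      (coordForm b i v * coordForm b j w)) • b k := by
  simp [christoffelForm, Fin.sum_univ_two, add_smul, mul_smul]

theorem metricForm_eq_inner (e : OpenPartialHomeomorph S E) (y v w : E) :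
    metricForm g b e y v w = g.inner (e.symm y) (mfderiv 𝓘(ℝ, E) 𝓘(ℝ, E) e.symm y v)
      (mfderiv 𝓘(ℝ, E) 𝓘(ℝ, E) e.symm y w) := by
  have hD (v : E) : mfderiv 𝓘(ℝ, E) 𝓘(ℝ, E) e.symm y v
      = coordForm b 0 v • coordVector b e 0 y + coordForm b 1 v • coordVector b e 1 y := by
    conv_lhs => rw [eq_coordForm_smul b v]
    exact (map_add _ _ _).trans (congrArg₂ _ (map_smul _ _ _) (map_smul _ _ _))
  rw [hD v, hD w, metricForm_apply]
  simp [Fin.sum_univ_two, metricMatrix]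
  ring

theorem metricForm_symm (e : OpenPartialHomeomorph S E) (y v w : E) :
    metricForm g b e y v w = metricForm g b e y w v := by
  rw [metricForm_eq_inner, metricForm_eq_inner, g.symm]

theorem metricForm_pos (he : e ∈ atlas E S) {y : E} (hy : y ∈ e.target) {v : E} (hv : v ≠ 0) :
    0 < metricForm g b e y v v := by
  rw [metricForm_eq_inner]
  refine g.pos _ _ fun h0 => hv ?_
  have hinj := (mdifferentiable_of_mem_atlas (I := 𝓘(ℝ, E)) he).symm.mfderiv_injective
    (x := y) hy
  exact hinj (h0.trans (map_zero _).symm)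

theorem metricForm_basis (e : OpenPartialHomeomorph S E) (y : E) (i j : Fin 2) :
    metricForm g b e y (b i) (b j) = metricMatrix g b e y i j := by
  rw [metricForm_eq_inner]
  rfl

theorem metricMatrix_symm (e : OpenPartialHomeomorph S E) (y : E) (i j : Fin 2) :
    metricMatrix g b e y i j = metricMatrix g b e y j i := by
  rw [← metricForm_basis, ← metricForm_basis, metricForm_symm]

theorem metricMatrix_det_pos (he : e ∈ atlas E S) {y : E} (hy : y ∈ e.target) :
    0 < (metricMatrix g b e y).det := by
  have h0 := metricForm_pos g b he hy (b.ne_zero 0)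
  rw [metricForm_basis] at h0
  set m := metricMatrix g b e y with hm
  -- This Gram–Schmidt vector, orthogonal to b 0, has squared length m₀₀ · det m.
  have hne : m 0 0 • b 1 - m 0 1 • b 0 ≠ 0 := by
    intro h
    have := congrArg (coordForm b 1) h
    simp at this
    exact h0.ne' this
  have h1 := metricForm_pos g b he hy hne
  have hs : m 1 0 = m 0 1 := metricMatrix_symm g b e y 1 0
  rw [metricForm_apply] at h1
  simp [Fin.sum_univ_two, ← hm, hs] at h1
  rw [Matrix.det_fin_two, hs]
  refine (mul_pos_iff_of_pos_left h0).1 ?_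
  linarith

theorem contDiffOn_metricMatrix_inv (he : e ∈ atlas E S) (k l : Fin 2) :
    ContDiffOn ℝ ∞ (fun y => (metricMatrix g b e y)⁻¹ k l) e.target := by
  have hm (i j : Fin 2) := contDiffOn_metricMatrix g b he i j
  have hdet : ContDiffOn ℝ ∞ (fun y => (metricMatrix g b e y).det) e.target := by
    simp only [Matrix.det_fin_two]
    exact ((hm 0 0).mul (hm 1 1)).sub ((hm 0 1).mul (hm 1 0))
  have hadj : ContDiffOn ℝ ∞ (fun y => (metricMatrix g b e y).adjugate k l) e.target := by
    simp only [Matrix.adjugate_fin_two]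
    fin_cases k <;> fin_cases l
    · exact hm 1 1
    · exact (hm 0 1).neg
    · exact (hm 1 0).neg
    · exact hm 0 0
  have hinv := hdet.inv fun y hy => (metricMatrix_det_pos g b he hy).ne'
  refine (hinv.mul hadj).congr fun y _ => ?_
  rw [Matrix.inv_def, Ring.inverse_eq_inv']
  rfl

theorem contDiffOn_christoffel (he : e ∈ atlas E S) (k i j : Fin 2) :
    ContDiffOn ℝ ∞ (christoffel g b e k i j) e.target := by
  have hp (i j l : Fin 2) : ContDiffOn ℝ ∞
      (partialDeriv b i fun x => metricMatrix g b e x j l) e.target :=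
    ((contDiffOn_metricMatrix g b he j l).fderiv_of_isOpen e.open_target (by simp)).clm_apply
      contDiffOn_const
  exact contDiffOn_const.mul (ContDiffOn.sum fun l _ =>
    (contDiffOn_metricMatrix_inv g b he k l).mul (((hp i j l).add (hp j i l)).sub (hp l i j)))

theorem contDiffOn_metricForm (he : e ∈ atlas E S) :
    ContDiffOn ℝ ∞ (metricForm g b e) e.target := by
  refine contDiffOn_clm_apply.2 fun v => contDiffOn_clm_apply.2 fun w => ?_
  simp only [metricForm_apply]
  exact ContDiffOn.sum fun i _ => ContDiffOn.sum fun j _ =>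
    (contDiffOn_metricMatrix g b he i j).mul contDiffOn_const

theorem contDiffOn_christoffelForm (he : e ∈ atlas E S) :
    ContDiffOn ℝ ∞ (christoffelForm g b e) e.target := by
  refine contDiffOn_clm_apply.2 fun v => contDiffOn_clm_apply.2 fun w => ?_
  simp only [christoffelForm_apply]
  exact ContDiffOn.sum fun k _ => (ContDiffOn.sum fun i _ => ContDiffOn.sum fun j _ =>
    (contDiffOn_christoffel g b he k i j).mul contDiffOn_const).smul contDiffOn_const

theorem christoffel_symm (e : OpenPartialHomeomorph S E) (k i j : Fin 2) (y : E) :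
    christoffel g b e k i j y = christoffel g b e k j i y := by
  have h : (fun x => metricMatrix g b e x i j) = fun x => metricMatrix g b e x j i := by
    funext x
    rw [metricMatrix_symm]
  simp only [christoffel, h]
  congr 1
  refine Finset.sum_congr rfl fun l _ => ?_
  ring

/-- Lowering the index cancels the inverse matrix, so that metric compatibility can be checked
without it. -/
theorem christoffel_lower (he : e ∈ atlas E S) {y : E} (hy : y ∈ e.target) (n i j : Fin 2) :
    ∑ k, metricMatrix g b e y n k * christoffel g b e k i j y
      = (1 / 2 : ℝ) * (partialDeriv b i (fun x => metricMatrix g b e x j n) y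
      + partialDeriv b j (fun x => metricMatrix g b e x i n) y
      - partialDeriv b n (fun x => metricMatrix g b e x i j) y) := by
  have hinv : metricMatrix g b e y * (metricMatrix g b e y)⁻¹ = 1 :=
    Matrix.mul_nonsing_inv _ (metricMatrix_det_pos g b he hy).ne'.isUnit
  have hnl (n l : Fin 2) := congrFun (congrFun hinv n) l
  simp only [Matrix.mul_apply, Fin.sum_univ_two] at hnl
  set D : Fin 2 → ℝ := fun n => partialDeriv b i (fun x => metricMatrix g b e x j n) y
      + partialDeriv b j (fun x => metricMatrix g b e x i n) y
      - partialDeriv b n (fun x => metricMatrix g b e x i j) y with hD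
  change ∑ k, metricMatrix g b e y n k * ((1 / 2 : ℝ) * ∑ l, (metricMatrix g b e y)⁻¹ k l * D l)
    = (1 / 2 : ℝ) * D n
  have hn : (1 : Matrix (Fin 2) (Fin 2) ℝ) n 0 * D 0 + (1 : Matrix (Fin 2) (Fin 2) ℝ) n 1 * D 1
      = D n := by
    fin_cases n <;> simp [Matrix.one_apply]
  rw [← hn]
  simp only [Fin.sum_univ_two]
  linear_combination (1 / 2 : ℝ) * D 0 * hnl n 0 + (1 / 2 : ℝ) * D 1 * hnl n 1

theorem fderiv_eq_partialDeriv (F : E → ℝ) (y v : E) :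
    fderiv ℝ F y v = coordForm b 0 v * partialDeriv b 0 F y
      + coordForm b 1 v * partialDeriv b 1 F y := by
  conv_lhs => rw [eq_coordForm_smul b v]
  simp [partialDeriv]

theorem fderiv_metricForm (he : e ∈ atlas E S) {y : E} (hy : y ∈ e.target) (a v w : E) :
    fderiv ℝ (metricForm g b e) y a v w = ∑ i, ∑ j,
      fderiv ℝ (fun x => metricMatrix g b e x i j) y a * (coordForm b i v * coordForm b j w) := by
  rw [fderiv_clm_apply₂
    ((contDiffOn_metricForm g b he).hasFDerivAt_of_isOpen e.open_target hy).differentiableAt]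
  simp only [metricForm_apply]
  have hd : HasFDerivAt (fun x => ∑ i, ∑ j, metricMatrix g b e x i j *
      (coordForm b i v * coordForm b j w)) _ y :=
    HasFDerivAt.fun_sum fun i _ => HasFDerivAt.fun_sum fun j _ =>
      ((contDiffOn_metricMatrix g b he i j).hasFDerivAt_of_isOpen e.open_target hy).mul_const
        (coordForm b i v * coordForm b j w)
  rw [hd.fderiv]
  simp [Fin.sum_univ_two]
  ring

theorem fderiv_christoffelForm (he : e ∈ atlas E S) {y : E} (hy : y ∈ e.target) (a v w : E) :
    fderiv ℝ (christoffelForm g b e) y a v w = ∑ k, (∑ i, ∑ j,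
      fderiv ℝ (christoffel g b e k i j) y a * (coordForm b i v * coordForm b j w)) • b k := by
  rw [fderiv_clm_apply₂
    ((contDiffOn_christoffelForm g b he).hasFDerivAt_of_isOpen e.open_target hy).differentiableAt]
  simp only [christoffelForm_apply]
  have hd : HasFDerivAt (fun x => ∑ k, (∑ i, ∑ j, christoffel g b e k i j x *
      (coordForm b i v * coordForm b j w)) • b k) _ y :=
    HasFDerivAt.fun_sum fun k _ => HasFDerivAt.smul_const (HasFDerivAt.fun_sum fun i _ =>
      HasFDerivAt.fun_sum fun j _ =>
        ((contDiffOn_christoffel g b he k i j).hasFDerivAt_of_isOpen e.open_target hy).mul_const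
          (coordForm b i v * coordForm b j w)) (b k)
  rw [hd.fderiv]
  simp [Fin.sum_univ_two]
  module

theorem partialDeriv_metricMatrix (he : e ∈ atlas E S) {y : E} (hy : y ∈ e.target)
    (p i j : Fin 2) : partialDeriv b p (fun x => metricMatrix g b e x i j) y
      = ∑ k, metricMatrix g b e y j k * christoffel g b e k p i y
        + ∑ k, metricMatrix g b e y i k * christoffel g b e k p j y := by
  have hs (i j : Fin 2) : (fun x => metricMatrix g b e x i j) = fun x => metricMatrix g b e x j i :=
    funext fun x => metricMatrix_symm g b e x i j
  rw [christoffel_lower g b he hy, christoffel_lower g b he hy, hs j i]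
  ring

theorem isLeviCivitaOn_christoffelForm (he : e ∈ atlas E S) :
    IsLeviCivitaOn (metricForm g b e) (christoffelForm g b e) e.target where
  isOpen := e.open_target
  contDiffOn_metric := contDiffOn_metricForm g b he
  contDiffOn_connection := contDiffOn_christoffelForm g b he
  metric_symm y _ := metricForm_symm g b e y
  metric_pos y hy _ := metricForm_pos g b he hy
  torsion_free y _ v w := by
    simp only [christoffelForm_apply, Fin.sum_univ_two, christoffel_symm g b e _ 1 0]
    congr 2 <;> ring
  compat y hy a v w := by
    rw [fderiv_metricForm g b he hy, metricForm_apply, metricForm_apply]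
    simp only [christoffelForm_apply, Fin.sum_univ_two, fderiv_eq_partialDeriv b,
      partialDeriv_metricMatrix g b he hy, map_add, map_smul, coordForm_basis, smul_eq_mul,
      metricMatrix_symm g b e y 1 0]
    simp
    ring

theorem connectionCurvature_basis (he : e ∈ atlas E S) {y : E} (hy : y ∈ e.target) :
    connectionCurvature (christoffelForm g b e) y (b 0) (b 1) (b 1)
      = ∑ l, curvatureCoeff g b e l 0 1 1 y • b l := by
  rw [connectionCurvature, fderiv_christoffelForm g b he hy, fderiv_christoffelForm g b he hy]
  simp only [christoffelForm_apply, Fin.sum_univ_two, map_add, map_smul, coordForm_basis,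
    curvatureCoeff, partialDeriv]
  simp
  module

theorem sectionalCurvature_nonpos (hg : HasNonposCurvature g) (he : e ∈ atlas E S) {y : E}
    (hy : y ∈ e.target) : metricForm g b e y
      (connectionCurvature (christoffelForm g b e) y (b 0) (b 1) (b 1)) (b 0) ≤ 0 := by
  have h := hg b e he y hy
  rw [gaussCurvature, div_le_iff₀ (metricMatrix_det_pos g b he hy), zero_mul] at h
  rw [connectionCurvature_basis g b he hy, map_sum, sum_apply]
  simpa [metricForm_basis] using h

end ChartConnection

/-! ### In a plane the curvature tensor is a single number. -/

section Planes

set_option synthInstance.maxHeartbeats 200000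

variable {E : Type*} [NormedAddCommGroup E] [NormedSpace ℝ E] [FiniteDimensional ℝ E]

theorem connectionCurvature_eq_det_smul (b : Module.Basis (Fin 2) ℝ E)
    (Γ : E → E →L[ℝ] E →L[ℝ] E) (y a c x : E) :
    connectionCurvature Γ y a c x
      = (coordForm b 0 a * coordForm b 1 c - coordForm b 1 a * coordForm b 0 c) •
        connectionCurvature Γ y (b 0) (b 1) x := by
  conv_lhs => rw [eq_coordForm_smul b a, eq_coordForm_smul b c]
  simp only [connectionCurvature, map_add, map_smul, add_apply, smul_apply]
  module

/-- The value for the pair a, c is det² times the value for the basis: one determinant comes from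
the alternation of R in its first two arguments, the other from its skewness with respect to the
metric. -/
theorem metric_connectionCurvature_nonpos (b : Module.Basis (Fin 2) ℝ E)
    {G : E → E →L[ℝ] E →L[ℝ] ℝ} {Γ : E → E →L[ℝ] E →L[ℝ] E} {y a c : E}
    (hskew : ∀ x x', G y (connectionCurvature Γ y a c x) x'
      = - G y x (connectionCurvature Γ y a c x'))
    (hsymm : ∀ v w, G y v w = G y w v)
    (hK : G y (connectionCurvature Γ y (b 0) (b 1) (b 1)) (b 0) ≤ 0) :
    G y (connectionCurvature Γ y a c c) a ≤ 0 := by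
  have hadd (x x' : E) (s t : ℝ) : connectionCurvature Γ y (b 0) (b 1) (s • x + t • x')
      = s • connectionCurvature Γ y (b 0) (b 1) x + t • connectionCurvature Γ y (b 0) (b 1) x' := by
    simp only [connectionCurvature, map_add, map_smul]
    module
  simp only [connectionCurvature_eq_det_smul b Γ y a c] at hskew ⊢
  set d := coordForm b 0 a * coordForm b 1 c - coordForm b 1 a * coordForm b 0 c with hd
  -- Skewness is known for R(a, c) = d R(b₀, b₁) only, so it passes to R(b₀, b₁) after cancelling d.
  rcases eq_or_ne d 0 with h0 | h0
  · simp [h0]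
  · have hS (x x' : E) : G y (connectionCurvature Γ y (b 0) (b 1) x) x'
        = - G y (connectionCurvature Γ y (b 0) (b 1) x') x := by
      have := hskew x x'
      rw [hsymm x] at this
      simp only [map_smul, smul_apply, smul_eq_mul] at this
      exact mul_left_cancel₀ h0 (by linarith)
    have h00 : G y (connectionCurvature Γ y (b 0) (b 1) (b 0)) (b 0) = 0 := by
      linarith [hS (b 0) (b 0)]
    have h11 : G y (connectionCurvature Γ y (b 0) (b 1) (b 1)) (b 1) = 0 := by
      linarith [hS (b 1) (b 1)]
    have key : G y (connectionCurvature Γ y (b 0) (b 1) c) a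
        = d * G y (connectionCurvature Γ y (b 0) (b 1) (b 1)) (b 0) := by
      conv_lhs => rw [eq_coordForm_smul b c, eq_coordForm_smul b a]
      rw [hadd]
      simp only [map_add, map_smul, add_apply, smul_apply, smul_eq_mul, h00, h11,
        hS (b 0) (b 1)]
      rw [hd]
      ring
    rw [map_smul, smul_apply, smul_eq_mul, key, ← mul_assoc]
    exact mul_nonpos_of_nonneg_of_nonpos (mul_self_nonneg d) hK

end Planes

/-! ### The energy density on the closed disc, read in charts. -/

section Disk

open Set Filter Topology Metric

theorem uniqueDiffOn_unit_closedBall : UniqueDiffOn ℝ (closedBall (0 : ℂ) 1) :=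
  uniqueDiffOn_convex (convex_closedBall _ _) <| by
    rw [interior_closedBall _ one_ne_zero]
    exact ⟨0, mem_ball_self one_pos⟩

variable {E : Type*} [NormedAddCommGroup E] [NormedSpace ℝ E] [FiniteDimensional ℝ E]
  {S : Type*} [TopologicalSpace S] [ChartedSpace E S] [IsManifold 𝓘(ℝ, E) ∞ S]
  (g : SmoothMetric E S) (b : Module.Basis (Fin 2) ℝ E) {e : OpenPartialHomeomorph S E}
  {u : ℂ → S}

theorem inner_mfderivWithin_eq_metricForm (he : e ∈ atlas E S) {s : Set ℂ} {z : ℂ}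
    (hs : UniqueDiffWithinAt ℝ s z) (hu : MDifferentiableWithinAt 𝓘(ℝ, ℂ) 𝓘(ℝ, E) u s z)
    (hz : u z ∈ e.source) (v w : ℂ) :
    g.inner (u z) (mfderivWithin 𝓘(ℝ, ℂ) 𝓘(ℝ, E) u s z v)
        (mfderivWithin 𝓘(ℝ, ℂ) 𝓘(ℝ, E) u s z w)
      = metricForm g b e (e (u z)) (fderivWithin ℝ (e ∘ u) s z v)
          (fderivWithin ℝ (e ∘ u) s z w) := by
  have hmd := mdifferentiable_of_mem_atlas (I := 𝓘(ℝ, E)) he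
  have h1 : mfderivWithin 𝓘(ℝ, ℂ) 𝓘(ℝ, E) (e ∘ u) s z
      = (mfderiv 𝓘(ℝ, E) 𝓘(ℝ, E) e (u z)).comp (mfderivWithin 𝓘(ℝ, ℂ) 𝓘(ℝ, E) u s z) :=
    mfderiv_comp_mfderivWithin z (hmd.mdifferentiableAt hz) hu hs.uniqueMDiffWithinAt
  have h2 (v : ℂ) : (mfderiv 𝓘(ℝ, E) 𝓘(ℝ, E) e.symm (e (u z)) (fderivWithin ℝ (e ∘ u) s z v) : E)
      = mfderivWithin 𝓘(ℝ, ℂ) 𝓘(ℝ, E) u s z v := by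
    rw [← mfderivWithin_eq_fderivWithin, h1]
    exact DFunLike.congr_fun (hmd.symm_comp_deriv hz) (mfderivWithin 𝓘(ℝ, ℂ) 𝓘(ℝ, E) u s z v)
  -- Transport along `e.symm (e (u z)) = u z`: tangent spaces at both points are E by definition.
  have h3 (p : S) (hp : p = u z) (x y : E) : g.inner p x y = g.inner (u z) x y := by
    subst hp
    rfl
  rw [metricForm_eq_inner]
  refine Eq.trans ?_ (h3 _ (e.left_inv hz) _ _).symm
  rw [h2, h2]

/-- The squared length of the image under `du` of a vector field on the closed unit disc. -/
noncomputable def diskEnergy (u : ℂ → S) (X : ℂ → ℂ) (z : ℂ) : ℝ :=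
  g.inner (u z) (mfderivWithin 𝓘(ℝ, ℂ) 𝓘(ℝ, E) u (closedBall 0 1) z (X z))
    (mfderivWithin 𝓘(ℝ, ℂ) 𝓘(ℝ, E) u (closedBall 0 1) z (X z))

omit [FiniteDimensional ℝ E] in
theorem diskEnergy_nonneg (X : ℂ → ℂ) (z : ℂ) : 0 ≤ diskEnergy g u X z := by
  rw [diskEnergy]
  by_cases h : mfderivWithin 𝓘(ℝ, ℂ) 𝓘(ℝ, E) u (closedBall 0 1) z (X z) = 0
  · rw [h]
    simp
  · exact (g.pos _ _ h).le

variable (hu : ContMDiffOn 𝓘(ℝ, ℂ) 𝓘(ℝ, E) ∞ u (closedBall 0 1))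

include hu

omit [FiniteDimensional ℝ E] in
/-- Near every point, a smooth map of the closed disc can be read in a chart. -/
theorem exists_isOpen_chart {z₀ : ℂ} (hz₀ : z₀ ∈ closedBall (0 : ℂ) 1) :
    ∃ O : Set ℂ, IsOpen O ∧ z₀ ∈ O ∧
      MapsTo u (closedBall 0 1 ∩ O) (chartAt E (u z₀)).source ∧
      ContDiffOn ℝ ∞ (chartAt E (u z₀) ∘ u) (closedBall 0 1 ∩ O) := by
  obtain ⟨O, hO, hOe⟩ := continuousOn_iff'.1 hu.continuousOn _ (chartAt E (u z₀)).open_source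
  have hmaps : MapsTo u (closedBall 0 1 ∩ O) (chartAt E (u z₀)).source := fun z hz => by
    have : z ∈ u ⁻¹' (chartAt E (u z₀)).source ∩ closedBall 0 1 := by
      rw [hOe]
      exact hz.symm
    exact this.1
  have hz₀O : z₀ ∈ O ∩ closedBall 0 1 := by
    rw [← hOe]
    exact ⟨mem_chart_source E (u z₀), hz₀⟩
  refine ⟨O, hO, hz₀O.1, hmaps, ?_⟩
  rw [← contMDiffOn_iff_contDiffOn]
  exact (contMDiffOn_chart (I := 𝓘(ℝ, E))).comp (hu.mono inter_subset_left) hmaps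

theorem diskEnergy_eq_metricForm {z₀ z : ℂ} (hz : z ∈ closedBall (0 : ℂ) 1)
    (hz' : u z ∈ (chartAt E (u z₀)).source) (v w : ℂ) :
    g.inner (u z) (mfderivWithin 𝓘(ℝ, ℂ) 𝓘(ℝ, E) u (closedBall 0 1) z v)
        (mfderivWithin 𝓘(ℝ, ℂ) 𝓘(ℝ, E) u (closedBall 0 1) z w)
      = metricForm g b (chartAt E (u z₀)) ((chartAt E (u z₀) ∘ u) z)
        (fderivWithin ℝ (chartAt E (u z₀) ∘ u) (closedBall 0 1) z v)
        (fderivWithin ℝ (chartAt E (u z₀) ∘ u) (closedBall 0 1) z w) :=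
  inner_mfderivWithin_eq_metricForm g b (chart_mem_atlas E _) (uniqueDiffOn_unit_closedBall z hz)
    ((hu z hz).mdifferentiableWithinAt (by simp)) hz' v w

include b in
theorem continuousOn_diskEnergy {X : ℂ → ℂ} (hX : Continuous X) :
    ContinuousOn (diskEnergy g u X) (closedBall 0 1) := by
  intro z₀ hz₀
  obtain ⟨O, hO, hz₀O, hmaps, hf⟩ := exists_isOpen_chart hu hz₀
  set e := chartAt E (u z₀) with he
  have hud : UniqueDiffOn ℝ (closedBall 0 1 ∩ O) := uniqueDiffOn_unit_closedBall.inter hO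
  -- Intersecting with the open set O does not change the derivative within the closed disc at
  -- points of O.
  have hf' : ContinuousOn (fderivWithin ℝ (e ∘ u) (closedBall 0 1)) (closedBall 0 1 ∩ O) :=
    (hf.continuousOn_fderivWithin hud (by simp)).congr fun z hz =>
      (fderivWithin_inter (hO.mem_nhds hz.2)).symm
  have hv := hf'.clm_apply hX.continuousOn
  have hcont : ContinuousOn (diskEnergy g u X) (closedBall 0 1 ∩ O) := by
    refine ContinuousOn.congr (f := fun z => metricForm g b e ((e ∘ u) z)
      (fderivWithin ℝ (e ∘ u) (closedBall 0 1) z (X z))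
      (fderivWithin ℝ (e ∘ u) (closedBall 0 1) z (X z))) ?_
      fun z hz => diskEnergy_eq_metricForm g b hu hz.1 (hmaps hz) _ _
    exact (((contDiffOn_metricForm g b (chart_mem_atlas E _)).continuousOn.comp hf.continuousOn
      fun z hz => e.map_source (hmaps hz)).clm_apply hv).clm_apply hv
  exact (hcont z₀ ⟨hz₀, hz₀O⟩).mono_of_mem_nhdsWithin
    (inter_mem self_mem_nhdsWithin (mem_nhdsWithin_of_mem_nhds (hO.mem_nhds hz₀O)))

end Disk

/-! ### Holomorphic maps: conformality and the inequality for the angular speed. -/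

section Holomorphic

open Set Filter Topology Metric

variable {E : Type*} [NormedAddCommGroup E] [NormedSpace ℝ E]
  {S : Type*} [TopologicalSpace S] [ChartedSpace E S] [IsManifold 𝓘(ℝ, E) ∞ S]
  {g : SmoothMetric E S} {J : ∀ p : S, TangentSpace 𝓘(ℝ, E) p →L[ℝ] TangentSpace 𝓘(ℝ, E) p}
  {u : ℂ → S}

omit [IsManifold 𝓘(ℝ, E) ∞ S] in
theorem mfderivWithin_I_mul (hol : IsHolomorphicInto J u (ball 0 1)) {z : ℂ} (hz : z ∈ ball 0 1)
    (v : ℂ) : mfderivWithin 𝓘(ℝ, ℂ) 𝓘(ℝ, E) u (closedBall 0 1) z (Complex.I * v : ℂ)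
      = J (u z) (mfderivWithin 𝓘(ℝ, ℂ) 𝓘(ℝ, E) u (closedBall 0 1) z v) := by
  have hnhds : closedBall (0 : ℂ) 1 ∈ 𝓝 z :=
    mem_of_superset (isOpen_ball.mem_nhds hz) ball_subset_closedBall
  rw [mfderivWithin_of_mem_nhds hnhds]
  exact (hol z hz).2 v

/-- For any v, g(v, Jv) = g(Jv, J²v) = -g(Jv, v), so v ⊥ Jv. -/
theorem inner_mfderivWithin_one_I (hJ : IsCompatibleComplexStructure g J)
    (hol : IsHolomorphicInto J u (ball 0 1)) {z : ℂ} (hz : z ∈ ball 0 1) :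
    g.inner (u z) (mfderivWithin 𝓘(ℝ, ℂ) 𝓘(ℝ, E) u (closedBall 0 1) z (1 : ℂ))
      (mfderivWithin 𝓘(ℝ, ℂ) 𝓘(ℝ, E) u (closedBall 0 1) z Complex.I) = 0 := by
  have h := mfderivWithin_I_mul hol hz 1
  rw [mul_one] at h
  rw [h]
  have h1 := hJ.isometry (u z) (mfderivWithin 𝓘(ℝ, ℂ) 𝓘(ℝ, E) u (closedBall 0 1) z (1 : ℂ))
    (J (u z) (mfderivWithin 𝓘(ℝ, ℂ) 𝓘(ℝ, E) u (closedBall 0 1) z (1 : ℂ)))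
  rw [hJ.sq_eq_neg, map_neg, g.symm] at h1
  linarith

theorem inner_mfderivWithin_I_mul (hJ : IsCompatibleComplexStructure g J)
    (hol : IsHolomorphicInto J u (ball 0 1)) {z : ℂ} (hz : z ∈ ball 0 1) (v : ℂ) :
    g.inner (u z) (mfderivWithin 𝓘(ℝ, ℂ) 𝓘(ℝ, E) u (closedBall 0 1) z (Complex.I * v : ℂ))
      (mfderivWithin 𝓘(ℝ, ℂ) 𝓘(ℝ, E) u (closedBall 0 1) z (Complex.I * v : ℂ))
    = g.inner (u z) (mfderivWithin 𝓘(ℝ, ℂ) 𝓘(ℝ, E) u (closedBall 0 1) z v)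
      (mfderivWithin 𝓘(ℝ, ℂ) 𝓘(ℝ, E) u (closedBall 0 1) z v) := by
  rw [mfderivWithin_I_mul hol hz, hJ.isometry]

theorem diskEnergy_angular (hJ : IsCompatibleComplexStructure g J)
    (hol : IsHolomorphicInto J u (ball 0 1)) {z : ℂ} (hz : z ∈ ball 0 1) :
    diskEnergy g u (fun z => Complex.I * z) z = ‖z‖ ^ 2 * diskEnergy g u (fun _ => 1) z := by
  rw [diskEnergy, inner_mfderivWithin_I_mul hJ hol hz, diskEnergy]
  set D := mfderivWithin 𝓘(ℝ, ℂ) 𝓘(ℝ, E) u (closedBall 0 1) z with hD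
  have hDz : D z = z.re • D (1 : ℂ) + z.im • D Complex.I := by
    have hz' : z = z.re • (1 : ℂ) + z.im • Complex.I := by
      apply Complex.ext <;> simp
    conv_lhs => rw [hz']
    exact (map_add D _ _).trans (congrArg₂ _ (map_smul D _ _) (map_smul D _ _))
  have h1 : g.inner (u z) (D (1 : ℂ)) (D Complex.I) = 0 := inner_mfderivWithin_one_I hJ hol hz
  have h2 : g.inner (u z) (D Complex.I) (D Complex.I) = g.inner (u z) (D (1 : ℂ)) (D (1 : ℂ)) := by
    have := inner_mfderivWithin_I_mul hJ hol hz 1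
    rwa [mul_one] at this
  have h3 := g.symm (u z) (D Complex.I) (D (1 : ℂ))
  rw [h1] at h3
  rw [hDz, ← Complex.normSq_eq_norm_sq, Complex.normSq_apply]
  simp only [map_add, map_smul, add_apply, smul_apply, smul_eq_mul, h1, h2, h3]
  ring

variable [FiniteDimensional ℝ E]

theorem planeLaplacian_congr {F F' : ℂ → ℝ} {z : ℂ} (h : F =ᶠ[𝓝 z] F') :
    planeLaplacian F z = planeLaplacian F' z := by
  rw [planeLaplacian, planeLaplacian, h.fderiv.fderiv_eq]

/-- The energy density of a holomorphic map is smooth, and its logarithm is subharmonic. -/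
theorem contDiffAt_and_log_laplacian_diskEnergy (hE : Module.finrank ℝ E = 2)
    (hg : HasNonposCurvature g) (hJ : IsCompatibleComplexStructure g J)
    (hu : ContMDiffOn 𝓘(ℝ, ℂ) 𝓘(ℝ, E) ∞ u (closedBall 0 1))
    (hol : IsHolomorphicInto J u (ball 0 1)) {z₀ : ℂ} (hz₀ : z₀ ∈ ball 0 1) :
    ContDiffAt ℝ 2 (diskEnergy g u fun _ => 1) z₀ ∧ (0 < diskEnergy g u (fun _ => 1) z₀ →
      (fderiv ℝ (diskEnergy g u fun _ => 1) z₀ 1) ^ 2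
        + (fderiv ℝ (diskEnergy g u fun _ => 1) z₀ Complex.I) ^ 2
      ≤ diskEnergy g u (fun _ => 1) z₀ * planeLaplacian (diskEnergy g u fun _ => 1) z₀) := by
  let b : Module.Basis (Fin 2) ℝ E := Module.finBasisOfFinrankEq ℝ E hE
  obtain ⟨O, hO, hz₀O, hmaps, hf⟩ := exists_isOpen_chart hu (ball_subset_closedBall hz₀)
  set e := chartAt E (u z₀) with he
  have hea : e ∈ atlas E S := chart_mem_atlas E _
  set f := e ∘ u with hfdef
  set U : Set ℂ := ball 0 1 ∩ O with hUdef
  have hUo : IsOpen U := isOpen_ball.inter hO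
  have hUsub : U ⊆ closedBall 0 1 ∩ O := inter_subset_inter_left _ ball_subset_closedBall
  have hfU : ContDiffOn ℝ ∞ f U := hf.mono hUsub
  have hfmaps : MapsTo f U e.target := fun z hz => e.map_source (hmaps (hUsub hz))
  have hLC := isLeviCivitaOn_christoffelForm g b hea
  have hin {z : ℂ} (hz : z ∈ U) (v w : ℂ) :
      metricForm g b e (f z) (fderiv ℝ f z v) (fderiv ℝ f z w)
      = g.inner (u z) (mfderivWithin 𝓘(ℝ, ℂ) 𝓘(ℝ, E) u (closedBall 0 1) z v)
        (mfderivWithin 𝓘(ℝ, ℂ) 𝓘(ℝ, E) u (closedBall 0 1) z w) := by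
    have hnhds : closedBall (0 : ℂ) 1 ∈ 𝓝 z :=
      mem_of_superset (isOpen_ball.mem_nhds hz.1) ball_subset_closedBall
    rw [diskEnergy_eq_metricForm g b hu (hUsub hz).1 (hmaps (hUsub hz)),
      fderivWithin_of_mem_nhds hnhds]
  have hB : (diskEnergy g u fun _ => 1) =ᶠ[𝓝 z₀]
      fun z => metricForm g b e (f z) (fderiv ℝ f z 1) (fderiv ℝ f z 1) := by
    filter_upwards [hUo.mem_nhds ⟨hz₀, hz₀O⟩] with z hz using (hin hz 1 1).symm
  have hsm := hLC.contDiffOn_metric_apply hfU hfmaps (hfU.fderiv_apply_of_isOpen hUo 1)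
    (hfU.fderiv_apply_of_isOpen hUo 1)
  refine ⟨((hsm.contDiffAt (hUo.mem_nhds ⟨hz₀, hz₀O⟩)).of_le
    (WithTop.coe_le_coe.2 le_top)).congr_of_eventuallyEq hB, fun hpos => ?_⟩
  rw [planeLaplacian_congr hB, hB.fderiv_eq, hB.eq_of_nhds]
  rw [hB.eq_of_nhds] at hpos
  -- The Bochner argument differentiates the harmonicity identity, so positivity of the energy is
  -- needed on a whole neighbourhood.
  set V : Set ℂ := U ∩ (fun z => metricForm g b e (f z) (fderiv ℝ f z 1) (fderiv ℝ f z 1)) ⁻¹'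
    Ioi 0 with hVdef
  have hVo : IsOpen V := hsm.continuousOn.isOpen_inter_preimage hUo isOpen_Ioi
  have hVU : V ⊆ U := inter_subset_left
  have hz₀V : z₀ ∈ V := ⟨⟨hz₀, hz₀O⟩, hpos⟩
  refine hLC.log_laplacian_energy hVo (hfU.mono hVU) (hfmaps.mono_left hVU) hE (fun z hz => ?_)
    (fun z hz => ?_) (fun z hz => hz.2) hz₀V ?_
  · have := inner_mfderivWithin_I_mul hJ hol (hVU hz).1 1
    rw [mul_one] at this
    rw [hin (hVU hz), hin (hVU hz), this]
  · rw [hin (hVU hz)]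
    exact inner_mfderivWithin_one_I hJ hol (hVU hz).1
  · exact metric_connectionCurvature_nonpos b
      (hLC.metric_curvature_skew hUo hfU hfmaps (hVU hz₀V) 1 Complex.I)
      (metricForm_symm g b e _)
      (sectionalCurvature_nonpos g b hg hea (hfmaps (hVU hz₀V)))

/-- The circle means of the angular speed of a holomorphic map of the unit disc, over the circles
with a given centre. -/
theorem circle_integrals_angularSpeed (hE : Module.finrank ℝ E = 2)
    (hg : HasNonposCurvature g) (hJ : IsCompatibleComplexStructure g J)
    (hu : ContMDiffOn 𝓘(ℝ, ℂ) 𝓘(ℝ, E) ∞ u (closedBall 0 1))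
    (hol : IsHolomorphicInto J u (ball 0 1)) {c : ℂ} {ρ : ℝ} (hρ : 0 < ρ)
    (hc : closedBall c ρ ⊆ closedBall 0 1) :
    ConvexOn ℝ (Iic 0) (fun t => ∫ θ in (0 : ℝ)..(2 * Real.pi),
      angularSpeed g u (circleMap c (ρ * Real.exp t) θ)) ∧
    MonotoneOn (fun t => ∫ θ in (0 : ℝ)..(2 * Real.pi),
      angularSpeed g u (circleMap c (ρ * Real.exp t) θ)) (Iic 0) ∧
    2 * Real.pi * angularSpeed g u c
      ≤ ∫ θ in (0 : ℝ)..(2 * Real.pi), angularSpeed g u (circleMap c ρ θ) := by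
  have hsub : ball c ρ ⊆ ball 0 1 := by
    have := interior_mono hc
    rwa [interior_closedBall _ hρ.ne', interior_closedBall _ one_ne_zero] at this
  have hF {z : ℂ} (hz : z ∈ ball c ρ) : diskEnergy g u (fun z => Complex.I * z) =ᶠ[𝓝 z]
      fun z => ‖z‖ ^ 2 * diskEnergy g u (fun _ => 1) z := by
    filter_upwards [isOpen_ball.mem_nhds (hsub hz)] with x hx using diskEnergy_angular hJ hol hx
  have hB {z : ℂ} (hz : z ∈ ball c ρ) :=
    contDiffAt_and_log_laplacian_diskEnergy hE hg hJ hu hol (hsub hz)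
  refine circle_integrals_sqrt hρ (diskEnergy_nonneg g _)
    ((continuousOn_diskEnergy g (Module.finBasisOfFinrankEq ℝ E hE) hu (by fun_prop)).mono hc)
    (fun z hz => ((contDiff_normSq.contDiffAt.mul (hB hz).1).congr_of_eventuallyEq
      (hF hz)).contDiffWithinAt) fun z hz hpos => ?_
  rw [planeLaplacian_congr (hF hz), (hF hz).fderiv_eq, (hF hz).eq_of_nhds]
  rw [(hF hz).eq_of_nhds] at hpos
  exact log_laplacian_mul contDiff_normSq.contDiffAt (hB hz).1 (log_laplacian_normSq z)
    ((hB hz).2 (pos_of_mul_pos_right hpos (by positivity)))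

end Holomorphic

/-! ### Assembly: the unit disc for the length, smaller discs for subharmonicity. -/

theorem mainTheorem4 {E : Type*} [NormedAddCommGroup E] [NormedSpace ℝ E]
    (hE : Module.finrank ℝ E = 2) {S : Type*} [TopologicalSpace S] [ChartedSpace E S]
    [IsManifold 𝓘(ℝ, E) ∞ S] (g : SmoothMetric E S) (hg : HasNonposCurvature g)
    (J : ∀ p : S, TangentSpace 𝓘(ℝ, E) p →L[ℝ] TangentSpace 𝓘(ℝ, E) p)
    (hJ : IsCompatibleComplexStructure g J)
    (u : ℂ → S) (hu : ContMDiffOn 𝓘(ℝ, ℂ) 𝓘(ℝ, E) ∞ u (Metric.closedBall 0 1))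
    (hol : IsHolomorphicInto J u (Metric.ball 0 1)) :
    (∀ r ∈ Set.Ioc (0 : ℝ) 1, IntervalIntegrable
      (fun θ : ℝ => angularSpeed g u (circleMap 0 r θ)) MeasureTheory.volume 0 (2 * Real.pi)) ∧
    MonotoneOn (circleLength g u) (Set.Ioc 0 1) ∧
    ConvexOn ℝ (Set.Iic 0) (fun t : ℝ => circleLength g u (Real.exp t)) ∧
    IsSubharmonicOn (angularSpeed g u) (Metric.ball 0 1) := by
  have : FiniteDimensional ℝ E := Module.finite_of_finrank_pos (by omega)
  have hcont : ContinuousOn (angularSpeed g u) (Metric.closedBall 0 1) :=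
    (continuousOn_diskEnergy g (Module.finBasisOfFinrankEq ℝ E hE) hu
      (X := fun z => Complex.I * z) (by fun_prop)).sqrt
  -- The unit disc itself is admissible, since only the closed disc must lie in the domain; hence
  -- the statements reach r = 1.
  obtain ⟨hconv, hmono, -⟩ := circle_integrals_angularSpeed hE hg hJ hu hol (c := 0) one_pos le_rfl
  simp only [one_mul] at hconv hmono
  refine ⟨fun r hr => ?_, fun r hr s hs hrs => ?_, hconv, ?_, fun c ρ hρ hc => ⟨?_, ?_⟩⟩
  · refine (hcont.comp_continuous (continuous_circleMap _ _) fun θ => ?_).intervalIntegrable _ _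
    exact Metric.closedBall_subset_closedBall hr.2 (circleMap_mem_closedBall 0 hr.1.le θ)
  · have h := hmono (show Real.log r ∈ Set.Iic 0 from Real.log_nonpos hr.1.le hr.2)
      (show Real.log s ∈ Set.Iic 0 from Real.log_nonpos hs.1.le hs.2) (Real.log_le_log hr.1 hrs)
    simp only [Real.exp_log hr.1, Real.exp_log hs.1] at h
    exact h
  · exact (hcont.mono Metric.ball_subset_closedBall).upperSemicontinuousOn
  · exact (hcont.mono ((Metric.sphere_subset_closedBall.trans hc).trans
      Metric.ball_subset_closedBall)).circleIntegrable hρ.le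
  · have h := (circle_integrals_angularSpeed hE hg hJ hu hol hρ
      (hc.trans Metric.ball_subset_closedBall)).2.2
    rw [Real.circleAverage_def, smul_eq_mul, ← div_eq_inv_mul, le_div_iff₀ (by positivity)]
    linarith
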